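/- A sequence $(q_n)_{n\in\mathbb N}$ of rationals is a Cauchy name for a real $x$ if $|q_n-q_k|\le 2^{-n}$ for all $k\ge n$ and $\lim_n q_n=x$; a family of reals $x_i$ is computable uniformly in $i$ if one algorithm computes from $i$ and $n$ the $n$-th term of a Cauchy name for $x_i$. A martingale is a function $M:\{0,1\}^{<\omega}\to[0,\infty)$ with $M(\sigma 0)+M(\sigma 1)=2M(\sigma)$ for every string $\sigma$; it is computable if the real $M(\sigma)$ is computable uniformly in $\sigma$; it succeeds on $Z\in\{0,1\}^{\mathbb N}$ if its values on the finite prefixes of $Z$ are unbounded. The sequence $Z$ is computably random if no computable martingale succeeds on $Z$, and a real $z\in[0,1]$ is computably random if it has a binary expansion $z=\sum_{n\ge 0}Z(n)2^{-n-1}$ with $Z$ computably random. A function $f:[0,1]\to\mathbb R$ is computable if $f(q)$ is a computable real uniformly in a rational $q\in[0,1]$, and there is a computable $h:\mathbb N\to\mathbb N$ such that, for all $n$ and all $x,y\in[0,1]$, $|x-y|<2^{-h(n)}$ implies $|f(x)-f(y)|<2^{-n}$. **Theorem 4.2.** Let $z\in[0,1]$. Then $z$ is computably random if and only if every computable Lipschitz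 function $f:[0,1]\to\mathbb R$ is differentiable at $z$ (differentiability being one-sided if $z\in\{0,1\}$). -/

import Mathlib

namespace CompRandom

/-- The standard numbering of the rationals by pairs (numerator, denominator minus one).
All computability of rationals below refers to this numbering. -/
def ratOf (p : ℤ × ℕ) : ℚ := (p.1 : ℚ) / ((p.2 : ℚ) + 1)

/-- `q` is a Cauchy name: `|q n - q k| ≤ 2⁻ⁿ` for all `k ≥ n`. -/
def IsCauchyName (q : ℕ → ℚ) : Prop :=
  ∀ n k : ℕ, n ≤ k → |q n - q k| ≤ (1 / 2 : ℚ) ^ n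

/-- `q` is a Cauchy name for the real `x`. -/
def IsCauchyNameFor (q : ℕ → ℚ) (x : ℝ) : Prop :=
  IsCauchyName q ∧ Filter.Tendsto (fun n => (q n : ℝ)) Filter.atTop (nhds x)

/-- A martingale: a nonnegative real-valued function on binary strings with
`M(σ0) + M(σ1) = 2 M(σ)`. -/
def IsMartingale (M : List Bool → ℝ) : Prop :=
  (∀ σ, 0 ≤ M σ) ∧ ∀ σ, M (σ ++ [false]) + M (σ ++ [true]) = 2 * M σ

/-- `M σ` is a computable real uniformly in the string `σ`: some computable function of `σ` and `n`
gives, for each `σ`, a Cauchy name for `M σ`. -/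
def IsComputableOnStrings (M : List Bool → ℝ) : Prop :=
  ∃ F : List Bool × ℕ → ℤ × ℕ, Computable F ∧
    ∀ σ, IsCauchyNameFor (fun n => ratOf (F (σ, n))) (M σ)

/-- The prefix of length `n` of the bit sequence `Z`. -/
def initialSegment (Z : ℕ → Bool) (n : ℕ) : List Bool := (List.range n).map Z

/-- `M` succeeds on `Z` if `M` is unbounded along the prefixes of `Z`. -/
def Succeeds (M : List Bool → ℝ) (Z : ℕ → Bool) : Prop :=
  ¬ BddAbove (Set.range fun n => M (initialSegment Z n))

/-- A bit sequence is computably random if no computable martingale succeeds on it. -/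
def IsComputablyRandomSeq (Z : ℕ → Bool) : Prop :=
  ∀ M : List Bool → ℝ, IsMartingale M → IsComputableOnStrings M → ¬ Succeeds M Z

/-- `Z` is a binary expansion of `z`, that is, `z = 0.Z(0)Z(1)Z(2)…` in base two. -/
def IsBinaryExpansion (Z : ℕ → Bool) (z : ℝ) : Prop :=
  HasSum (fun n => if Z n = true then (1 / 2 : ℝ) ^ (n + 1) else 0) z

/-- A real (in `[0, 1]`) is computably random if a binary expansion of it is. -/
def IsComputablyRandom (z : ℝ) : Prop :=
  ∃ Z : ℕ → Bool, IsBinaryExpansion Z z ∧ IsComputablyRandomSeq Z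

/-- Condition (a) for computability of `f : [0,1] → ℝ`: `f q` is a computable real uniformly in a
rational `q ∈ [0, 1]`. Only the restriction of `f` to `[0, 1]` matters. -/
def IsComputableOnRationals (f : ℝ → ℝ) : Prop :=
  ∃ F : (ℤ × ℕ) × ℕ → ℤ × ℕ, Computable F ∧
    ∀ p : ℤ × ℕ, (ratOf p : ℝ) ∈ Set.Icc (0 : ℝ) 1 →
      IsCauchyNameFor (fun n => ratOf (F (p, n))) (f (ratOf p : ℝ))

/-- Condition (b) for computability of `f : [0,1] → ℝ`: effective uniform continuity. -/
def IsEffectivelyUniformlyContinuous (f : ℝ → ℝ) : Prop :=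
  ∃ h : ℕ → ℕ, Computable h ∧
    ∀ n : ℕ, ∀ x ∈ Set.Icc (0 : ℝ) 1, ∀ y ∈ Set.Icc (0 : ℝ) 1,
      |x - y| < (1 / 2 : ℝ) ^ h n → |f x - f y| < (1 / 2 : ℝ) ^ n

/-- Computability of a function `f : [0,1] → ℝ`, given as a function on `ℝ` of which only the
restriction to `[0, 1]` matters. -/
def IsComputableOnUnitInterval (f : ℝ → ℝ) : Prop :=
  IsComputableOnRationals f ∧ IsEffectivelyUniformlyContinuous f

end CompRandom

/-! Fair functions on strings are the dyadic slopes of functions on the unit interval. The average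
slopes of any function are fair (`slopeOn_fair`), and a fair `X` of at most linear growth is the
slope function of its distribution function `cdf X` (`slopeOn_cdf`). Bounded `X` give Lipschitz
functions, nonnegative `X` nondecreasing ones.

Suppose `z` is not computably random. Some computable martingale succeeds on a binary expansion of
`z`, and `exists_rat_martingale` yields a rational-valued `R ≥ 1`, unbounded along it. Copying the
relative bets of `R` up to a fixed gain, then doing the same with the opposite sign, and so on,
gives a bounded fair function `osc R` that takes each of the values `1` and `-1` infinitely often
along the expansion (`exists_osc_eq`). Its distribution function is computable and Lipschitz, but
its slopes on dyadic intervals containing `z` do not converge, so it has no derivative at `z`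
(`tendsto_slopeOn`).

Suppose conversely that `z` has a computably random expansion. The slopes of a computable
nondecreasing function form a computable martingale, hence are bounded along the expansion
(`bddAbove_slopeOn`). This transfers to the points `(z + θ) / 2` with `θ` rational in the unit
interval: a martingale with bounded losses stays bounded along the expansion of such a point
(`HasSavings.exists_le_path`).

For a bounded fair `R`, such martingales arise as a bounded potential plus an accumulated
nonnegative gain, and the gain must then be bounded (`IsRandomPath.exists_le`). The potential `C² -
R²` shows that the increments of `R` vanish in the limit, even at strings branching off the path at
bounded depth. A potential built from the play (hysteresis) operator shows that `R` converges along
the path. Applied to the slopes of a Lipschitz function, this makes the function nearly linear on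
the dyadic intervals around the point (`IsRandomPath.exists_slope`).

Dyadic intervals containing `z` need not contain the points close to `z`. The one-third trick
repairs this: of two dyadic grids shifted against each other by `1/3`, at least one has an interval
of comparable length containing both `z` and a given nearby point (`mem_gridInterval_or`). The
slopes obtained from the two grids agree because the intervals overlap substantially
(`exists_mem_gridIntervals`). -/

namespace CompRandom

/-! ### Primitive recursive integer arithmetic -/

section Integers

theorem primrec_int_toNat : Primrec Int.toNat := by
  have h : Primrec fun x : ℤ => if Encodable.encode x % 2 = 0 then Encodable.encode x / 2 else 0 :=
    Primrec.ite (Primrec.eq.comp (Primrec.nat_mod.comp Primrec.encode (Primrec.const 2))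
      (Primrec.const 0)) (Primrec.nat_div.comp Primrec.encode (Primrec.const 2)) (Primrec.const 0)
  refine h.of_eq fun x => ?_
  rcases x with n | n
  · have : Encodable.encode (Int.ofNat n) = 2 * n := rfl
    rw [this]; simp
  · have : Encodable.encode (Int.negSucc n) = 2 * n + 1 := rfl
    rw [this]; simp

theorem primrec_int_neg_toNat : Primrec fun x : ℤ => (-x).toNat := by
  have h : Primrec fun x : ℤ => if Encodable.encode x % 2 = 0 then 0
      else Encodable.encode x / 2 + 1 :=
    Primrec.ite (Primrec.eq.comp (Primrec.nat_mod.comp Primrec.encode (Primrec.const 2))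
      (Primrec.const 0)) (Primrec.const 0)
      (Primrec.succ.comp (Primrec.nat_div.comp Primrec.encode (Primrec.const 2)))
  refine h.of_eq fun x => ?_
  rcases x with n | n
  · have : Encodable.encode (Int.ofNat n) = 2 * n := rfl
    rw [this]; simp
  · have : Encodable.encode (Int.negSucc n) = 2 * n + 1 := rfl
    rw [this]
    have : (2 * n + 1) / 2 = n := by omega
    simp [this]

theorem primrec_int_sub_nat : Primrec₂ fun m n : ℕ => (m : ℤ) - n := by
  have h : Primrec₂ fun m n : ℕ => if n ≤ m then 2 * (m - n) else 2 * (n - m - 1) + 1 := by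
    refine Primrec.ite (Primrec.nat_le.comp Primrec.snd Primrec.fst)
      (Primrec.nat_double.comp (Primrec.nat_sub.comp Primrec.fst Primrec.snd))
      (Primrec.nat_double_succ.comp (Primrec.nat_sub.comp
        (Primrec.nat_sub.comp Primrec.snd Primrec.fst) (Primrec.const 1)))
  refine Primrec₂.encode_iff.1 (h.of_eq fun m n => ?_)
  split_ifs with hmn
  · have : (m : ℤ) - n = Int.ofNat (m - n) := by simp [Nat.cast_sub hmn]
    rw [this]; rfl
  · have : (m : ℤ) - n = Int.negSucc (n - m - 1) := by omega
    rw [this]; rfl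

/-- Each factor is split into its positive and negative parts, leaving a difference of two natural
numbers. A sum of two products is exactly the numerator needed to add fractions. -/
theorem primrec_int_mul_add : Primrec fun p : (ℤ × ℤ) × (ℤ × ℤ) =>
    p.1.1 * p.1.2 + p.2.1 * p.2.2 := by
  have a {f : (ℤ × ℤ) × (ℤ × ℤ) → ℤ} (hf : Primrec f) := primrec_int_toNat.comp hf
  have b {f : (ℤ × ℤ) × (ℤ × ℤ) → ℤ} (hf : Primrec f) := primrec_int_neg_toNat.comp hf
  have f1 : Primrec fun p : (ℤ × ℤ) × (ℤ × ℤ) => p.1.1 := Primrec.fst.comp Primrec.fst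
  have f2 : Primrec fun p : (ℤ × ℤ) × (ℤ × ℤ) => p.1.2 := Primrec.snd.comp Primrec.fst
  have f3 : Primrec fun p : (ℤ × ℤ) × (ℤ × ℤ) => p.2.1 := Primrec.fst.comp Primrec.snd
  have f4 : Primrec fun p : (ℤ × ℤ) × (ℤ × ℤ) => p.2.2 := Primrec.snd.comp Primrec.snd
  have m {f g : (ℤ × ℤ) × (ℤ × ℤ) → ℕ} (hf : Primrec f) (hg : Primrec g) :=
    Primrec.nat_mul.comp hf hg
  have s {f g : (ℤ × ℤ) × (ℤ × ℤ) → ℕ} (hf : Primrec f) (hg : Primrec g) :=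
    Primrec.nat_add.comp hf hg
  refine (primrec_int_sub_nat.comp
    (s (s (m (a f1) (a f2)) (m (b f1) (b f2))) (s (m (a f3) (a f4)) (m (b f3) (b f4))))
    (s (s (m (a f1) (b f2)) (m (b f1) (a f2))) (s (m (a f3) (b f4)) (m (b f3) (a f4))))).of_eq
    fun p => ?_
  have e (x : ℤ) : x = x.toNat - (-x).toNat := by omega
  push_cast
  conv_rhs => rw [e p.1.1, e p.1.2, e p.2.1, e p.2.2]
  ring

theorem primrec_int_mul : Primrec₂ fun x y : ℤ => x * y :=
  (primrec_int_mul_add.comp (Primrec.pair Primrec.id (Primrec.const (0, 0)))).of_eq fun p => by simp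

theorem primrec_int_natCast : Primrec fun n : ℕ => (n : ℤ) :=
  (primrec_int_sub_nat.comp Primrec.id (Primrec.const 0)).of_eq fun p => by simp

theorem primrec_int_natAbs : Primrec Int.natAbs :=
  (Primrec.nat_add.comp primrec_int_toNat primrec_int_neg_toNat).of_eq fun p => by omega

theorem primrec_int_div_nat : Primrec₂ fun (x : ℤ) (d : ℕ) => x.sign * (x.natAbs / d : ℕ) := by
  refine (primrec_int_sub_nat.comp
    (Primrec.nat_div.comp (primrec_int_toNat.comp Primrec.fst) Primrec.snd)
    (Primrec.nat_div.comp (primrec_int_neg_toNat.comp Primrec.fst) Primrec.snd)).of_eq fun p => ?_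
  rcases p with ⟨x, d⟩
  rcases lt_trichotomy x 0 with h | h | h
  · have h1 : x.toNat = 0 := by omega
    have h2 : (-x).toNat = x.natAbs := by omega
    simp [h1, h2, Int.sign_eq_neg_one_of_neg h]
  · simp [h]
  · have h1 : (-x).toNat = 0 := by omega
    have h2 : x.toNat = x.natAbs := by omega
    simp [h1, h2, Int.sign_eq_one_of_pos h]

/-- A bounded search for the greatest common divisor; the positive second argument supplies the
bound. -/
theorem primrec_nat_gcd_succ : Primrec₂ fun m n : ℕ => Nat.gcd m (n + 1) := by
  have h : Primrec₂ fun m n : ℕ =>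
      Nat.findGreatest (fun k => m % k = 0 ∧ (n + 1) % k = 0) (n + 1) := by
    refine Primrec.nat_findGreatest (Primrec.succ.comp Primrec.snd)
      (p := fun (x : ℕ × ℕ) k => x.1 % k = 0 ∧ (x.2 + 1) % k = 0) ?_
    refine PrimrecPred.and ?_ ?_
    · exact Primrec.eq.comp (Primrec.nat_mod.comp (Primrec.fst.comp Primrec.fst) Primrec.snd)
        (Primrec.const 0)
    · exact Primrec.eq.comp (Primrec.nat_mod.comp (Primrec.succ.comp
        (Primrec.snd.comp Primrec.fst)) Primrec.snd) (Primrec.const 0)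
  refine h.of_eq fun m n => ?_
  rw [Nat.findGreatest_eq_iff]
  refine ⟨Nat.gcd_le_right _ (Nat.succ_pos n), fun _ => ⟨?_, ?_⟩, fun k hk hkn hd => ?_⟩
  · exact Nat.mod_eq_zero_of_dvd (Nat.gcd_dvd_left _ _)
  · exact Nat.mod_eq_zero_of_dvd (Nat.gcd_dvd_right _ _)
  · have := Nat.dvd_gcd (Nat.dvd_of_mod_eq_zero hd.1) (Nat.dvd_of_mod_eq_zero hd.2)
    have h := Nat.le_of_dvd (Nat.gcd_pos_of_pos_right m (Nat.succ_pos n)) this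
    exact absurd h (not_le.2 hk)

end Integers

/-! ### Primitive recursive rational arithmetic -/

section Rationals

theorem ratOf_code (q : ℚ) : ratOf (q.num, q.den - 1) = q := by
  have h : ((q.den - 1 : ℕ) : ℚ) + 1 = q.den := by
    exact_mod_cast Nat.sub_add_cancel q.den_pos
  simp only [ratOf, h]
  exact Rat.num_div_den q

theorem num_ratOf (p : ℤ × ℕ) :
    (ratOf p).num = p.1.sign * (p.1.natAbs / Nat.gcd p.1.natAbs (p.2 + 1) : ℕ) := by
  have h : ratOf p = Rat.divInt p.1 (p.2 + 1 : ℕ) := by simp [ratOf, Rat.divInt_eq_div]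
  rw [h, Rat.num_divInt]
  rcases p with ⟨x, d⟩
  have e : Int.gcd x ((d + 1 : ℕ) : ℤ) = Nat.gcd x.natAbs (d + 1) := rfl
  have s : ((d + 1 : ℕ) : ℤ).sign = 1 := Int.sign_eq_one_of_pos (by positivity)
  rw [Int.gcd_comm]
  simp only [e, s, one_mul]
  have hd : Nat.gcd x.natAbs (d + 1) ∣ x.natAbs := Nat.gcd_dvd_left _ _
  rw [Int.natCast_div, ← Int.mul_ediv_assoc _ (by exact_mod_cast hd), Int.sign_mul_natAbs]

theorem den_ratOf (p : ℤ × ℕ) :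
    (ratOf p).den = (p.2 + 1) / Nat.gcd p.1.natAbs (p.2 + 1) := by
  have h : ratOf p = Rat.divInt p.1 (p.2 + 1 : ℕ) := by simp [ratOf, Rat.divInt_eq_div]
  rw [h, Rat.den_divInt]
  have : ((p.2 + 1 : ℕ) : ℤ) ≠ 0 := by positivity
  rw [if_neg this]
  rw [Int.natAbs_natCast, Int.gcd_comm]
  rfl

theorem primrecPred_coprime_code :
    PrimrecPred fun p : ℤ × ℕ => Nat.gcd p.1.natAbs (p.2 + 1) = 1 :=
  Primrec.eq.comp (primrec_nat_gcd_succ.comp (primrec_int_natAbs.comp Primrec.fst) Primrec.snd)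
    (Primrec.const 1)

/-- Rationals correspond to codes in lowest terms. -/
def ratEquivCode : ℚ ≃ {p : ℤ × ℕ // Nat.gcd p.1.natAbs (p.2 + 1) = 1} where
  toFun q := ⟨(q.num, q.den - 1), by
    show Nat.gcd q.num.natAbs (q.den - 1 + 1) = 1
    rw [Nat.sub_add_cancel q.den_pos]; exact q.reduced⟩
  invFun p := ratOf p.1
  left_inv q := ratOf_code q
  right_inv p := by
    rcases p with ⟨⟨x, d⟩, h⟩
    apply Subtype.ext
    apply Prod.ext
    · show (ratOf (x, d)).num = x
      rw [num_ratOf]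
      simp only at h
      simp only [h, Nat.div_one]
      exact Int.sign_mul_natAbs x
    · show (ratOf (x, d)).den - 1 = d
      rw [den_ratOf]
      simp only at h
      simp [h]

/-- Rationals are coded by their lowest terms, rather than through `Denumerable ℚ`. -/
instance ratPrimcodable : Primcodable ℚ :=
  letI := Primcodable.subtype primrecPred_coprime_code
  Primcodable.ofEquiv _ ratEquivCode

theorem primrec_rat_code : Primrec fun q : ℚ => (q.num, q.den - 1) := by
  let := Primcodable.subtype primrecPred_coprime_code
  exact Primrec.subtype_val.comp (Primrec.of_equiv (e := ratEquivCode))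

theorem primrec_rat_num : Primrec fun q : ℚ => q.num := Primrec.fst.comp primrec_rat_code

theorem primrec_rat_den : Primrec fun q : ℚ => q.den :=
  (Primrec.succ.comp (Primrec.snd.comp primrec_rat_code)).of_eq fun q =>
    Nat.sub_add_cancel q.den_pos

theorem primrec_ratOf : Primrec ratOf := by
  let := Primcodable.subtype primrecPred_coprime_code
  refine (Primrec.of_equiv_iff ratEquivCode).1 (Primrec.subtype_val_iff.1 ?_)
  have g : Primrec fun p : ℤ × ℕ => Nat.gcd p.1.natAbs (p.2 + 1) :=
    primrec_nat_gcd_succ.comp (primrec_int_natAbs.comp Primrec.fst) Primrec.snd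
  refine Primrec.pair ((primrec_int_div_nat.comp Primrec.fst g).of_eq fun p => (num_ratOf p).symm)
    ((Primrec.nat_sub.comp (Primrec.nat_div.comp (Primrec.succ.comp Primrec.snd) g)
      (Primrec.const 1)).of_eq fun p => ?_)
  show _ = (ratOf p).den - 1
  rw [den_ratOf]

theorem primrec_rat_div_int_nat : Primrec₂ fun (x : ℤ) (d : ℕ) => (x : ℚ) / d := by
  refine (Primrec.ite (Primrec.eq.comp Primrec.snd (Primrec.const 0)) (Primrec.const 0)
    (primrec_ratOf.comp (Primrec.pair Primrec.fst (Primrec.nat_sub.comp Primrec.snd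
      (Primrec.const 1))))).of_eq fun p => ?_
  rcases p with ⟨x, _ | d⟩ <;> simp [ratOf]

theorem primrec_rat_add : Primrec₂ fun x y : ℚ => x + y := by
  refine (primrec_rat_div_int_nat.comp (primrec_int_mul_add.comp (Primrec.pair
    (Primrec.pair (primrec_rat_num.comp Primrec.fst)
      (primrec_int_natCast.comp (primrec_rat_den.comp Primrec.snd)))
    (Primrec.pair (primrec_rat_num.comp Primrec.snd)
      (primrec_int_natCast.comp (primrec_rat_den.comp Primrec.fst)))))
    (Primrec.nat_mul.comp (primrec_rat_den.comp Primrec.fst)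
      (primrec_rat_den.comp Primrec.snd))).of_eq fun p => ?_
  have h1 : (p.1.den : ℚ) ≠ 0 := by exact_mod_cast p.1.den_nz
  have h2 : (p.2.den : ℚ) ≠ 0 := by exact_mod_cast p.2.den_nz
  conv_rhs => rw [← Rat.num_div_den p.1, ← Rat.num_div_den p.2]
  push_cast
  field_simp

theorem primrec_rat_mul : Primrec₂ fun x y : ℚ => x * y := by
  refine (primrec_rat_div_int_nat.comp (primrec_int_mul.comp (primrec_rat_num.comp Primrec.fst)
      (primrec_rat_num.comp Primrec.snd))
    (Primrec.nat_mul.comp (primrec_rat_den.comp Primrec.fst)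
      (primrec_rat_den.comp Primrec.snd))).of_eq fun p => ?_
  conv_rhs => rw [← Rat.num_div_den p.1, ← Rat.num_div_den p.2]
  push_cast
  rw [div_mul_div_comm]

theorem primrec_rat_inv : Primrec fun x : ℚ => x⁻¹ := by
  refine (primrec_rat_div_int_nat.comp (primrec_int_mul.comp primrec_rat_num
      (primrec_int_natCast.comp primrec_rat_den))
    (Primrec.nat_mul.comp (primrec_int_natAbs.comp primrec_rat_num)
      (primrec_int_natAbs.comp primrec_rat_num))).of_eq fun p => ?_
  conv_rhs => rw [← Rat.num_div_den p]
  have : ((p.num.natAbs * p.num.natAbs : ℕ) : ℚ) = p.num * p.num := by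
    rw [← Int.cast_natCast, Int.natAbs_mul_self, Int.cast_mul]
  rw [this]
  rcases eq_or_ne (p.num : ℚ) 0 with h | h
  · simp [h]
  · push_cast
    field_simp

theorem primrec_rat_natCast : Primrec fun n : ℕ => (n : ℚ) :=
  (primrec_rat_div_int_nat.comp primrec_int_natCast (Primrec.const 1)).of_eq fun n => by simp

theorem primrec_rat_neg : Primrec fun x : ℚ => -x :=
  (primrec_rat_mul.comp (Primrec.const (-1)) Primrec.id).of_eq fun x => by simp

theorem primrec_rat_sub : Primrec₂ fun x y : ℚ => x - y :=
  (primrec_rat_add.comp Primrec.fst (primrec_rat_neg.comp Primrec.snd)).of_eq fun x => by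
    simp [sub_eq_add_neg]

theorem primrec_rat_div : Primrec₂ fun x y : ℚ => x / y :=
  (primrec_rat_mul.comp Primrec.fst (primrec_rat_inv.comp Primrec.snd)).of_eq fun x => by
    simp [div_eq_mul_inv]

theorem primrecRel_rat_le : PrimrecRel fun x y : ℚ => x ≤ y := by
  refine (Primrec.eq.comp (primrec_int_neg_toNat.comp (primrec_rat_num.comp
    (primrec_rat_sub.comp Primrec.snd Primrec.fst))) (Primrec.const 0)).of_eq fun p => ?_
  show _ ↔ p.1 ≤ p.2
  rw [← sub_nonneg, ← Rat.num_nonneg]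
  omega

theorem primrec_rat_min : Primrec₂ fun x y : ℚ => min x y :=
  (Primrec.ite (primrecRel_rat_le.comp Primrec.fst Primrec.snd) Primrec.fst
    Primrec.snd).of_eq fun p => (min_def p.1 p.2).symm

theorem primrec_rat_max : Primrec₂ fun x y : ℚ => max x y :=
  (Primrec.ite (primrecRel_rat_le.comp Primrec.fst Primrec.snd) Primrec.snd
    Primrec.fst).of_eq fun p => (max_def p.1 p.2).symm

theorem primrec_rat_natFloor : Primrec fun x : ℚ => ⌊x⌋₊ := by
  refine (Primrec.nat_div.comp (primrec_int_toNat.comp primrec_rat_num) primrec_rat_den).of_eq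
    fun x => ?_
  rw [← Int.floor_toNat, Rat.floor_def']
  rcases le_total 0 x.num with h | h
  · lift x.num to ℕ using h with n
    exact_mod_cast rfl
  · have : x.num / x.den ≤ 0 := Int.ediv_nonpos_of_nonpos_of_neg h (by positivity)
    rw [Int.toNat_of_nonpos h, Int.toNat_of_nonpos this, Nat.zero_div]

theorem primrec_nat_pow : Primrec₂ fun m n : ℕ => m ^ n :=
  Primrec₂.unpaired'.1 Nat.Primrec.pow

theorem primrec_rat_pow_two : Primrec fun n : ℕ => (2 : ℚ) ^ n :=
  (primrec_rat_natCast.comp (primrec_nat_pow.comp (Primrec.const 2) Primrec.id)).of_eq fun n => by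
    simp

end Rationals

end CompRandom

-- Automation for closure properties of computable functions

attribute [fun_prop] Computable

namespace CompRandom

section Closure

variable {α β γ S : Type*} [Primcodable α] [Primcodable β] [Primcodable γ] [Primcodable S]

@[fun_prop]
theorem computable_id' : Computable fun a : α => a := Computable.id

@[fun_prop]
theorem computable_const' (b : β) : Computable fun _ : α => b := Computable.const b

@[fun_prop]
theorem computable_comp' {f : β → γ} {g : α → β} (hf : Computable f) (hg : Computable g) :
    Computable fun a => f (g a) := hf.comp hg

@[fun_prop]
theorem computable_pair' {f : α → β} {g : α → γ} (hf : Computable f) (hg : Computable g) :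
    Computable fun a => (f a, g a) := hf.pair hg

@[fun_prop]
theorem computable_fst' {f : α → β × γ} (hf : Computable f) : Computable fun a => (f a).1 :=
  Computable.fst.comp hf

@[fun_prop]
theorem computable_snd' {f : α → β × γ} (hf : Computable f) : Computable fun a => (f a).2 :=
  Computable.snd.comp hf

@[fun_prop]
theorem computable_rat_add {f g : α → ℚ} (hf : Computable f) (hg : Computable g) :
    Computable fun a => f a + g a := primrec_rat_add.to_comp.comp hf hg

@[fun_prop]
theorem computable_rat_sub {f g : α → ℚ} (hf : Computable f) (hg : Computable g) :
    Computable fun a => f a - g a := primrec_rat_sub.to_comp.comp hf hg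

@[fun_prop]
theorem computable_rat_mul {f g : α → ℚ} (hf : Computable f) (hg : Computable g) :
    Computable fun a => f a * g a := primrec_rat_mul.to_comp.comp hf hg

@[fun_prop]
theorem computable_rat_div {f g : α → ℚ} (hf : Computable f) (hg : Computable g) :
    Computable fun a => f a / g a := primrec_rat_div.to_comp.comp hf hg

@[fun_prop]
theorem computable_rat_neg {f : α → ℚ} (hf : Computable f) :
    Computable fun a => -f a := primrec_rat_neg.to_comp.comp hf

@[fun_prop]
theorem computable_rat_min {f g : α → ℚ} (hf : Computable f) (hg : Computable g) :
    Computable fun a => min (f a) (g a) := primrec_rat_min.to_comp.comp hf hg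

@[fun_prop]
theorem computable_rat_max {f g : α → ℚ} (hf : Computable f) (hg : Computable g) :
    Computable fun a => max (f a) (g a) := primrec_rat_max.to_comp.comp hf hg

@[fun_prop]
theorem computable_rat_natCast {f : α → ℕ} (hf : Computable f) :
    Computable fun a => (f a : ℚ) := primrec_rat_natCast.to_comp.comp hf

@[fun_prop]
theorem computable_rat_natFloor {f : α → ℚ} (hf : Computable f) :
    Computable fun a => ⌊f a⌋₊ := primrec_rat_natFloor.to_comp.comp hf

@[fun_prop]
theorem computable_rat_two_pow {f : α → ℕ} (hf : Computable f) :
    Computable fun a => (2 : ℚ) ^ f a := primrec_rat_pow_two.to_comp.comp hf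

@[fun_prop]
theorem computable_ratOf {f : α → ℤ × ℕ} (hf : Computable f) :
    Computable fun a => ratOf (f a) := primrec_ratOf.to_comp.comp hf

@[fun_prop]
theorem computable_rat_code {f : α → ℚ} (hf : Computable f) :
    Computable fun a => ((f a).num, (f a).den - 1) := primrec_rat_code.to_comp.comp hf

@[fun_prop]
theorem computable_nat_add {f g : α → ℕ} (hf : Computable f) (hg : Computable g) :
    Computable fun a => f a + g a := Primrec.nat_add.to_comp.comp hf hg

@[fun_prop]
theorem computable_nat_mul {f g : α → ℕ} (hf : Computable f) (hg : Computable g) :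
    Computable fun a => f a * g a := Primrec.nat_mul.to_comp.comp hf hg

@[fun_prop]
theorem computable_cons {f : α → β} {g : α → List β} (hf : Computable f) (hg : Computable g) :
    Computable fun a => f a :: g a := Computable.list_cons.comp hf hg

@[fun_prop]
theorem computable_length {f : α → List β} (hf : Computable f) :
    Computable fun a => (f a).length := Computable.list_length.comp hf

@[fun_prop]
theorem computable_append {f g : α → List β} (hf : Computable f) (hg : Computable g) :
    Computable fun a => f a ++ g a := Computable.list_append.comp hf hg

@[fun_prop]
theorem computable_not {f : α → Bool} (hf : Computable f) :
    Computable fun a => !f a := Primrec.not.to_comp.comp hf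

@[fun_prop]
theorem computable_bif {c : α → Bool} {f g : α → β} (hc : Computable c) (hf : Computable f)
    (hg : Computable g) : Computable fun a => bif c a then f a else g a := Computable.cond hc hf hg

/-- The comparison of rationals as a Boolean function. -/
@[irreducible] def ratLE (x y : ℚ) : Bool := decide (x ≤ y)

theorem ratLE_iff {x y : ℚ} : ratLE x y = true ↔ x ≤ y := by simp [ratLE]

@[fun_prop]
theorem computable_ratLE {f g : α → ℚ} (hf : Computable f) (hg : Computable g) :
    Computable fun a => ratLE (f a) (g a) := by
  have h : Primrec fun p : ℚ × ℚ => if p.1 ≤ p.2 then true else false :=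
    Primrec.ite (primrecRel_rat_le.comp Primrec.fst Primrec.snd) (Primrec.const true)
      (Primrec.const false)
  have h' : Computable₂ ratLE :=
    h.to_comp.of_eq fun p => by
      rw [Bool.eq_iff_iff, ratLE_iff]; simp
  exact h'.comp hf hg

theorem computable_nat_rec {f : α → ℕ} {g : α → S} {h : α → ℕ → S → S} (hf : Computable f)
    (hg : Computable g) (hh : Computable fun p : α × ℕ × S => h p.1 p.2.1 p.2.2) :
    Computable fun a => Nat.rec (motive := fun _ => S) (g a) (h a) (f a) :=
  Computable.nat_rec hf hg (h := fun a p => h a p.1 p.2) hh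

end Closure

/-! ### Recursion along binary strings -/

section Paths

variable {S : Type*}

/-- Recursion along a binary string, reading one further bit at its end. -/
def pathRec (s₀ : S) (step : List Bool → Bool → S → S) (σ : List Bool) : S :=
  Nat.rec s₀ (fun n s => step (σ.take n) (σ.getD n false) s) σ.length

theorem pathRec_nil (s₀ : S) (step : List Bool → Bool → S → S) : pathRec s₀ step [] = s₀ := rfl

theorem pathRec_concat (s₀ : S) (step : List Bool → Bool → S → S) (σ : List Bool) (b : Bool) :
    pathRec s₀ step (σ ++ [b]) = step σ b (pathRec s₀ step σ) := by
  have h (n : ℕ) (hn : n ≤ σ.length) :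
      (Nat.rec s₀ (fun n s => step ((σ ++ [b]).take n) ((σ ++ [b]).getD n false) s) n : S) =
      Nat.rec s₀ (fun n s => step (σ.take n) (σ.getD n false) s) n := by
    induction n with
    | zero => rfl
    | succ n ih =>
      simp only
      rw [ih (by omega), List.take_append_of_le_length (by omega),
        List.getD_append _ _ _ _ (by omega)]
  have e : (σ ++ [b]).length = σ.length + 1 := by simp
  rw [pathRec, e]
  simp only
  rw [h _ le_rfl]
  simp [pathRec]

theorem computable_pathRec [Primcodable S] (s₀ : S) {step : List Bool → Bool → S → S}
    (h : Computable fun p : List Bool × Bool × S => step p.1 p.2.1 p.2.2) :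
    Computable (pathRec s₀ step) := by
  unfold pathRec
  have h1 : Computable fun p : List Bool × ℕ × S => p.1.take p.2.1 :=
    Primrec.list_take.to_comp.comp (by fun_prop) (by fun_prop)
  have h2 : Computable fun p : List Bool × ℕ × S => p.1.getD p.2.1 false :=
    (Primrec.list_getD false).to_comp.comp (by fun_prop) (by fun_prop)
  refine computable_nat_rec (by fun_prop) (by fun_prop) ?_
  exact h.comp (h1.pair (h2.pair (by fun_prop)))

end Paths

/-! ### Strings as dyadic intervals -/

section Strings

/-- The number with binary digits `σ`. -/
def num (σ : List Bool) : ℕ := σ.foldl (fun a b => 2 * a + b.toNat) 0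

@[simp] theorem num_nil : num [] = 0 := rfl

@[simp] theorem num_concat (σ : List Bool) (b : Bool) : num (σ ++ [b]) = 2 * num σ + b.toNat := by
  simp [num]

@[fun_prop]
theorem computable_num : Computable num := by
  have : Primrec num :=
    Primrec.list_foldl Primrec.id (Primrec.const 0) (h := fun _ (p : ℕ × Bool) => 2 * p.1 + p.2.toNat)
      (Primrec.nat_add.comp (Primrec.nat_mul.comp (Primrec.const 2)
        (Primrec.fst.comp Primrec.snd)) ((Primrec.dom_bool _).comp (Primrec.snd.comp Primrec.snd)))
  exact this.to_comp

theorem num_lt (σ : List Bool) : num σ < 2 ^ σ.length := by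
  induction σ using List.reverseRecOn with
  | nil => simp
  | append_singleton σ b ih =>
    have := b.toNat_le
    simp only [num_concat, List.length_append, List.length_singleton, pow_succ]
    omega

/-- The last `m` binary digits of `j`. -/
def str : ℕ → ℕ → List Bool
  | 0, _ => []
  | m + 1, j => str m (j / 2) ++ [decide (j % 2 = 1)]

theorem str_eq_map (m j : ℕ) :
    str m j = (List.range m).map fun i => decide (j / 2 ^ (m - 1 - i) % 2 = 1) := by
  induction m generalizing j with
  | zero => rfl
  | succ m ih =>
    rw [str, ih, List.range_succ, List.map_append]
    congr 1
    · refine List.map_congr_left fun i hi => ?_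
      have := List.mem_range.1 hi
      have e : m + 1 - 1 - i = (m - 1 - i) + 1 := by omega
      rw [Nat.div_div_eq_div_mul, e, pow_succ']
    · simp

@[fun_prop]
theorem computable_str {α : Type*} [Primcodable α] {f g : α → ℕ} (hf : Computable f)
    (hg : Computable g) : Computable fun a => str (f a) (g a) := by
  have : Primrec fun p : ℕ × ℕ => str p.1 p.2 := by
    have hi : Primrec fun q : (ℕ × ℕ) × ℕ => q.1.1 - 1 - q.2 :=
      Primrec.nat_sub.comp (Primrec.nat_sub.comp (Primrec.fst.comp Primrec.fst)
        (Primrec.const 1)) Primrec.snd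
    have hd : Primrec fun q : (ℕ × ℕ) × ℕ => q.1.2 / 2 ^ (q.1.1 - 1 - q.2) % 2 :=
      Primrec.nat_mod.comp (Primrec.nat_div.comp (Primrec.snd.comp Primrec.fst)
        (primrec_nat_pow.comp (Primrec.const 2) hi)) (Primrec.const 2)
    have hb : Primrec₂ fun (p : ℕ × ℕ) (i : ℕ) => decide (p.2 / 2 ^ (p.1 - 1 - i) % 2 = 1) :=
      primrecPred_iff_primrec_decide.1 (Primrec.eq.comp hd (Primrec.const 1))
    exact (Primrec.list_map (Primrec.list_range.comp Primrec.fst) hb).of_eq fun p =>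
      (str_eq_map p.1 p.2).symm
  exact this.to_comp.comp (hf.pair hg)

@[simp] theorem length_str (m j : ℕ) : (str m j).length = m := by simp [str_eq_map]

theorem str_two_mul (m j : ℕ) : str (m + 1) (2 * j) = str m j ++ [false] := by
  rw [str]; simp

theorem str_two_mul_add_one (m j : ℕ) : str (m + 1) (2 * j + 1) = str m j ++ [true] := by
  rw [str]
  have : (2 * j + 1) / 2 = j := by omega
  simp [this]

@[simp] theorem str_num (σ : List Bool) : str σ.length (num σ) = σ := by
  induction σ using List.reverseRecOn with
  | nil => rfl
  | append_singleton σ b ih =>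
    cases b
    · simpa [str_two_mul] using ih
    · simpa [str_two_mul_add_one] using ih

theorem num_str {m j : ℕ} (h : j < 2 ^ m) : num (str m j) = j := by
  induction m generalizing j with
  | zero => simp at h; simp [h, str]
  | succ m ih =>
    rw [pow_succ] at h
    rw [str, num_concat, ih (by omega)]
    rcases Nat.mod_two_eq_zero_or_one j with h | h <;> simp [h] <;> omega

theorem str_add (n k i : ℕ) {j : ℕ} (h : j < 2 ^ k) :
    str (n + k) (2 ^ k * i + j) = str n i ++ str k j := by
  induction k generalizing j with
  | zero => simp at h; simp [h, str]
  | succ k ih =>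
    rw [pow_succ] at h
    have e1 : (2 ^ (k + 1) * i + j) / 2 = 2 ^ k * i + j / 2 := by
      rw [pow_succ, mul_comm (2 ^ k) 2, mul_assoc]; omega
    have e2 : (2 ^ (k + 1) * i + j) % 2 = j % 2 := by
      rw [pow_succ, mul_comm (2 ^ k) 2, mul_assoc]; omega
    rw [← add_assoc, str, str, e1, e2, ih (by omega), List.append_assoc]

end Strings

/-! ### Signed dyadic measures and their distribution functions -/

open Filter Topology

/-- The increments are dominated by telescoping differences of `e`, so `e m` bounds the whole tail.
-/
theorem exists_tendsto_of_abs_sub_le {a e : ℕ → ℝ} (h : ∀ m, |a (m + 1) - a m| ≤ e m - e (m + 1))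
    (he : Tendsto e atTop (𝓝 0)) :
    ∃ L, Tendsto a atTop (𝓝 L) ∧ ∀ m, |a m - L| ≤ e m := by
  have hle (m k : ℕ) : |a (m + k) - a m| ≤ e m - e (m + k) := by
    induction k with
    | zero => simp
    | succ k ih =>
      have := abs_sub_le (a (m + (k + 1))) (a (m + k)) (a m)
      have := h (m + k)
      rw [add_assoc] at this
      linarith
  have he0 (m : ℕ) : 0 ≤ e m := by
    have h1 : Tendsto (fun k => e m - e (k + m)) atTop (𝓝 (e m - 0)) :=
      tendsto_const_nhds.sub ((tendsto_add_atTop_iff_nat m).2 he)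
    rw [sub_zero] at h1
    refine ge_of_tendsto' h1 fun k => ?_
    rw [add_comm k m]
    exact (abs_nonneg _).trans (hle m k)
  have hle' (m n : ℕ) (hmn : m ≤ n) : |a n - a m| ≤ e m := by
    obtain ⟨k, rfl⟩ := Nat.exists_eq_add_of_le hmn
    linarith [hle m k, he0 (m + k)]
  have hc : CauchySeq a := by
    refine cauchySeq_of_le_tendsto_0' e (fun n m hnm => ?_) he
    rw [dist_comm, Real.dist_eq]
    exact hle' n m hnm
  obtain ⟨L, hL⟩ := cauchySeq_tendsto_of_complete hc
  refine ⟨L, hL, fun m => ?_⟩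
  rw [abs_sub_comm]
  refine le_of_tendsto ((hL.sub tendsto_const_nhds).abs) ?_
  filter_upwards [eventually_ge_atTop m] with n hn using hle' m n hn

theorem tendsto_add_three_div_two_pow (K : ℝ) :
    Tendsto (fun m : ℕ => K * (m + 3) / 2 ^ m) atTop (𝓝 0) := by
  have h1 : Tendsto (fun m : ℕ => (m : ℝ) * (1 / 2 : ℝ) ^ m) atTop (𝓝 0) :=
    tendsto_self_mul_const_pow_of_lt_one (by norm_num) (by norm_num)
  have h2 : Tendsto (fun m : ℕ => (1 / 2 : ℝ) ^ m) atTop (𝓝 0) :=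
    tendsto_pow_atTop_nhds_zero_of_lt_one (by norm_num) (by norm_num)
  have h3 := (h1.const_mul K).add (h2.const_mul (3 * K))
  simp only [mul_zero, add_zero] at h3
  refine h3.congr fun m => ?_
  rw [one_div, inv_pow]
  field_simp

/-- The fairness condition for a (possibly signed) rational-valued martingale. -/
def IsFair (X : List Bool → ℚ) : Prop := ∀ σ, X (σ ++ [false]) + X (σ ++ [true]) = 2 * X σ

/-- The mass `X` gives to the first `k` dyadic intervals of level `m`. -/
def massBelow (X : List Bool → ℚ) (m k : ℕ) : ℚ := (∑ j ∈ Finset.range k, X (str m j)) / 2 ^ m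

section

variable {X : List Bool → ℚ}

theorem massBelow_succ (m k : ℕ) :
    massBelow X m (k + 1) = massBelow X m k + X (str m k) / 2 ^ m := by
  rw [massBelow, Finset.sum_range_succ, add_div, massBelow]

theorem massBelow_two_mul (hX : IsFair X) (m k : ℕ) :
    massBelow X (m + 1) (2 * k) = massBelow X m k := by
  induction k with
  | zero => simp [massBelow]
  | succ k ih =>
    rw [mul_add, mul_one, massBelow_succ, massBelow_succ, massBelow_succ, ih, str_two_mul,
      str_two_mul_add_one, add_assoc, ← add_div, hX, pow_succ]
    field_simp

theorem massBelow_two_pow_mul (hX : IsFair X) (m i k : ℕ) :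
    massBelow X (m + i) (2 ^ i * k) = massBelow X m k := by
  induction i with
  | zero => simp
  | succ i ih => rw [← add_assoc, pow_succ', mul_assoc, massBelow_two_mul hX, ih]

theorem computable_massBelow (hX : Computable X) {α : Type*} [Primcodable α] {f g : α → ℕ}
    (hf : Computable f) (hg : Computable g) : Computable fun a => massBelow X (f a) (g a) := by
  have h : Computable fun a =>
      (Nat.rec 0 (fun j s => s + X (str (f a) j)) (g a) : ℚ) / 2 ^ f a := by
    refine computable_rat_div (computable_nat_rec hg (by fun_prop) ?_) (by fun_prop)
    fun_prop
  refine h.of_eq fun a => ?_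
  rw [massBelow]
  congr 1
  induction g a with
  | zero => simp
  | succ k ih => rw [Finset.sum_range_succ, ← ih]

/-- The level `m` approximation to the distribution function of `X`. -/
noncomputable def cdfApprox (X : List Bool → ℚ) (m : ℕ) (x : ℝ) : ℝ := massBelow X m ⌊2 ^ m * x⌋₊

/-- The distribution function of the signed measure given by `X`. -/
noncomputable def cdf (X : List Bool → ℚ) (x : ℝ) : ℝ := limUnder atTop fun m => cdfApprox X m x

/-- At most linear growth in the length of the string. -/
def HasLinearGrowth (X : List Bool → ℚ) (K : ℚ) : Prop := ∀ σ, |X σ| ≤ K * (σ.length + 1)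

theorem natFloor_two_mul {x : ℝ} (hx : 0 ≤ x) :
    ⌊2 * x⌋₊ = 2 * ⌊x⌋₊ ∨ ⌊2 * x⌋₊ = 2 * ⌊x⌋₊ + 1 := by
  have h1 := Nat.floor_le hx
  have h2 := Nat.lt_floor_add_one x
  have h3 : 2 * ⌊x⌋₊ ≤ ⌊2 * x⌋₊ := Nat.le_floor (by push_cast; linarith)
  have h4 : ⌊2 * x⌋₊ < 2 * ⌊x⌋₊ + 2 := (Nat.floor_lt (by positivity)).2 (by push_cast; linarith)
  omega

theorem abs_cdfApprox_succ_sub_le {K : ℚ} (hX : IsFair X) (hK : HasLinearGrowth X K) {x : ℝ}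
    (hx : 0 ≤ x) (m : ℕ) :
    |cdfApprox X (m + 1) x - cdfApprox X m x| ≤ K * (m + 2) / 2 ^ (m + 1) := by
  have hK0 : 0 ≤ K := by simpa using (abs_nonneg _).trans (hK [])
  rw [cdfApprox, cdfApprox, pow_succ', mul_assoc]
  rcases natFloor_two_mul (x := 2 ^ m * x) (by positivity) with h | h
  · rw [h, massBelow_two_mul hX, sub_self, abs_zero]
    have : (0 : ℝ) ≤ K := by exact_mod_cast hK0
    positivity
  · rw [h, massBelow_succ, massBelow_two_mul hX, pow_succ']
    push_cast
    rw [add_sub_cancel_left, abs_div, abs_of_pos (by positivity : (0 : ℝ) < 2 * 2 ^ m)]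
    refine div_le_div_of_nonneg_right ?_ (by positivity)
    have := hK (str (m + 1) (2 * ⌊2 ^ m * x⌋₊))
    rw [length_str] at this
    have : ((|X (str (m + 1) (2 * ⌊2 ^ m * x⌋₊))| : ℚ) : ℝ) ≤ ((K * ((m + 1 : ℕ) + 1) : ℚ) : ℝ) :=
      by exact_mod_cast this
    push_cast at this
    linarith

theorem cdf_spec {K : ℚ} (hX : IsFair X) (hK : HasLinearGrowth X K) {x : ℝ} (hx : 0 ≤ x) :
    Tendsto (fun m => cdfApprox X m x) atTop (𝓝 (cdf X x)) ∧
      ∀ m : ℕ, |cdfApprox X m x - cdf X x| ≤ K * (m + 3) / 2 ^ m := by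
  -- This `e` solves `e m - e (m + 1) = K (m + 2) / 2 ^ (m + 1)`, the one-step bound.
  obtain ⟨L, hL, h⟩ := exists_tendsto_of_abs_sub_le (a := fun m => cdfApprox X m x)
    (e := fun m : ℕ => K * (m + 3) / 2 ^ m) (fun m => by
      refine (abs_cdfApprox_succ_sub_le hX hK hx m).trans (le_of_eq ?_)
      push_cast
      rw [pow_succ]
      field_simp
      ring) (tendsto_add_three_div_two_pow K)
  have : cdf X x = L := hL.limUnder_eq
  rw [this]
  exact ⟨hL, h⟩

theorem cdf_dyadic (hX : IsFair X) (n k : ℕ) : cdf X (k / 2 ^ n) = massBelow X n k := by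
  refine Tendsto.limUnder_eq (tendsto_const_nhds.congr' ?_)
  filter_upwards [eventually_ge_atTop n] with m hm
  obtain ⟨i, rfl⟩ := Nat.exists_eq_add_of_le hm
  have : (2 : ℝ) ^ (n + i) * (k / 2 ^ n) = (2 ^ i * k : ℕ) := by
    rw [pow_add]; push_cast; field_simp
  rw [cdfApprox, this, Nat.floor_natCast, massBelow_two_pow_mul hX]

theorem cdf_dyadic_sub (hX : IsFair X) (n k : ℕ) :
    cdf X ((k + 1) / 2 ^ n) - cdf X (k / 2 ^ n) = X (str n k) / 2 ^ n := by
  have h : ((k : ℝ) + 1) = ((k + 1 : ℕ) : ℝ) := by push_cast; ring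
  rw [h, cdf_dyadic hX, cdf_dyadic hX, massBelow_succ]
  push_cast
  ring

theorem le_mul_massBelow_sub {m a b : ℕ} (hab : a ≤ b) {s c : ℚ}
    (h : ∀ j, a ≤ j → j < b → c ≤ s * X (str m j)) :
    c * (b - a) / 2 ^ m ≤ s * (massBelow X m b - massBelow X m a) := by
  induction b, hab using Nat.le_induction with
  | base => simp
  | succ b hab ih =>
    have h1 := ih fun j h1 h2 => h j h1 (by omega)
    have h2 := div_le_div_of_nonneg_right (h b hab (by omega)) (by positivity : (0 : ℚ) ≤ 2 ^ m)
    rw [massBelow_succ]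
    push_cast
    have e1 : c * ((b : ℚ) + 1 - a) / 2 ^ m = c * (b - a) / 2 ^ m + c / 2 ^ m := by ring
    have e2 : s * (massBelow X m b + X (str m b) / 2 ^ m - massBelow X m a) =
      s * (massBelow X m b - massBelow X m a) + s * X (str m b) / 2 ^ m := by ring
    rw [e1, e2]
    linarith

/-- The sign `s = ±1` lets one statement serve for lower and upper slope bounds. Only fine levels
matter, since the increment is a limit of masses of dyadic blocks. -/
theorem le_mul_cdf_sub {K : ℚ} (hX : IsFair X) (hK : HasLinearGrowth X K) {u v : ℝ} (hu : 0 ≤ u)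
    (huv : u ≤ v) {s c : ℚ} (m₀ : ℕ)
    (h : ∀ m, m₀ ≤ m → ∀ j, ⌊2 ^ m * u⌋₊ ≤ j → j < ⌊2 ^ m * v⌋₊ → c ≤ s * X (str m j)) :
    c * (v - u) ≤ s * (cdf X v - cdf X u) := by
  have hfl {x : ℝ} (hx : 0 ≤ x) :
      Tendsto (fun m : ℕ => (⌊(2 : ℝ) ^ m * x⌋₊ : ℝ) / 2 ^ m) atTop (𝓝 x) := by
    have := (tendsto_nat_floor_mul_div_atTop hx).comp
      (tendsto_pow_atTop_atTop_of_one_lt (r := (2 : ℝ)) (by norm_num))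
    refine this.congr fun m => ?_
    simp [mul_comm x]
  have h1 := ((hfl (hu.trans huv)).sub (hfl hu)).const_mul (c : ℝ)
  have h2 := ((cdf_spec hX hK (hu.trans huv)).1.sub (cdf_spec hX hK hu).1).const_mul (s : ℝ)
  refine le_of_tendsto_of_tendsto h1 h2 ?_
  filter_upwards [eventually_ge_atTop m₀] with m hm
  have hab : ⌊2 ^ m * u⌋₊ ≤ ⌊2 ^ m * v⌋₊ := Nat.floor_mono (by gcongr)
  have := le_mul_massBelow_sub hab (h m hm)
  have : ((c * (⌊2 ^ m * v⌋₊ - ⌊2 ^ m * u⌋₊) / 2 ^ m : ℚ) : ℝ) ≤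
    ((s * (massBelow X m ⌊2 ^ m * v⌋₊ - massBelow X m ⌊2 ^ m * u⌋₊) : ℚ) : ℝ) := by
    exact_mod_cast this
  push_cast at this
  rw [cdfApprox, cdfApprox, ← sub_div, ← mul_div_assoc]
  exact this

theorem abs_cdf_sub_le {C : ℚ} (hX : IsFair X) (hC : ∀ σ, |X σ| ≤ C) {u v : ℝ} (hu : 0 ≤ u)
    (hv : 0 ≤ v) : |cdf X u - cdf X v| ≤ C * |u - v| := by
  have hK : HasLinearGrowth X C := fun σ => (hC σ).trans (by
    have : 0 ≤ C := (abs_nonneg _).trans (hC σ)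
    have : 0 ≤ C * σ.length := by positivity
    linarith)
  wlog huv : u ≤ v generalizing u v
  · rw [abs_sub_comm, abs_sub_comm u]
    exact this hv hu (le_of_not_ge huv)
  have h1 := le_mul_cdf_sub hX hK hu huv (s := 1) (c := -C) 0 fun m _ j _ _ => by
    have := neg_abs_le (X (str m j)); have := hC (str m j); linarith
  have h2 := le_mul_cdf_sub hX hK hu huv (s := -1) (c := -C) 0 fun m _ j _ _ => by
    have := le_abs_self (X (str m j)); have := hC (str m j); linarith
  push_cast at h1 h2
  rw [abs_sub_comm, abs_sub_comm u, abs_of_nonneg (sub_nonneg.2 huv), abs_le]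
  constructor <;> linarith

theorem cdf_mono {K : ℚ} (hX : IsFair X) (hK : HasLinearGrowth X K) (h0 : ∀ σ, 0 ≤ X σ) {u v : ℝ}
    (hu : 0 ≤ u) (huv : u ≤ v) : cdf X u ≤ cdf X v := by
  have := le_mul_cdf_sub hX hK hu huv (s := 1) (c := 0) 0 fun m _ j _ _ => by
    simpa using h0 (str m j)
  push_cast at this
  linarith

/-- A rational approximation, of exponential precision, to the distribution function of `X`. -/
def cdfRat (X : List Bool → ℚ) (q : ℚ) (p : ℕ) : ℚ := massBelow X (2 * p) ⌊2 ^ (2 * p) * q⌋₊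

theorem computable_cdfRat (hX : Computable X) {α : Type*} [Primcodable α] {f : α → ℚ} {g : α → ℕ}
    (hf : Computable f) (hg : Computable g) : Computable fun a => cdfRat X (f a) (g a) :=
  computable_massBelow hX (by fun_prop) (by fun_prop)

/-- Working at level `2 * p` absorbs the linear factor: `2p + 3 ≤ 3 · 2 ^ p`. -/
theorem abs_cdfRat_sub_le {K : ℚ} (hX : IsFair X) (hK : HasLinearGrowth X K) {q : ℚ} (hq : 0 ≤ q)
    (p : ℕ) : |(cdfRat X q p : ℝ) - cdf X q| ≤ 3 * K / 2 ^ p := by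
  have h := (cdf_spec hX hK (x := (q : ℝ)) (by exact_mod_cast hq)).2 (2 * p)
  have e : ⌊(2 : ℝ) ^ (2 * p) * (q : ℝ)⌋₊ = ⌊2 ^ (2 * p) * q⌋₊ := by
    rw [← Int.floor_toNat, ← Int.floor_toNat, ← Rat.floor_cast (α := ℝ)]
    push_cast
    rfl
  rw [cdfApprox, e] at h
  refine h.trans ?_
  have hK0 : (0 : ℝ) ≤ K := by exact_mod_cast (by simpa using (abs_nonneg _).trans (hK []) : 0 ≤ K)
  have hp : (p : ℝ) + 1 ≤ 2 ^ p := by exact_mod_cast Nat.lt_two_pow_self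
  rw [two_mul p, pow_add, div_le_div_iff₀ (by positivity) (by positivity)]
  push_cast
  have : (p : ℝ) + p + 3 ≤ 3 * 2 ^ p := by linarith
  have := mul_le_mul_of_nonneg_left this (by positivity : 0 ≤ K * (2 : ℝ) ^ p)
  linarith

end

/-! ### Cauchy names and rational approximations -/

section CauchyNames

theorem IsCauchyNameFor.abs_sub_le {q : ℕ → ℚ} {x : ℝ} (h : IsCauchyNameFor q x) (n : ℕ) :
    |(q n : ℝ) - x| ≤ 1 / 2 ^ n := by
  refine le_of_tendsto ((tendsto_const_nhds.sub h.2).abs) ?_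
  filter_upwards [eventually_ge_atTop n] with k hk
  have := h.1 n k hk
  have : ((|q n - q k| : ℚ) : ℝ) ≤ (((1 / 2 : ℚ) ^ n : ℚ) : ℝ) := by exact_mod_cast this
  push_cast at this
  rwa [one_div_pow] at this

theorem isCauchyNameFor_of_abs_sub_le {q : ℕ → ℚ} {x : ℝ} (h : ∀ n, |(q n : ℝ) - x| ≤ 1 / 2 ^ n) :
    IsCauchyNameFor (fun n => q (n + 1)) x := by
  constructor
  · intro n k hnk
    have h1 := h (n + 1)
    have h2 := h (k + 1)
    have h3 : (1 : ℝ) / 2 ^ (k + 1) ≤ 1 / 2 ^ (n + 1) :=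
      one_div_le_one_div_of_le (by positivity) (pow_le_pow_right₀ (by norm_num) (by omega))
    have h4 := abs_sub_le (q (n + 1) : ℝ) x (q (k + 1))
    rw [abs_sub_comm x] at h4
    have h5 : (1 : ℝ) / 2 ^ (n + 1) + 1 / 2 ^ (n + 1) = (1 / 2) ^ n := by
      rw [one_div_pow, pow_succ]; field_simp; norm_num
    have : ((|q (n + 1) - q (k + 1)| : ℚ) : ℝ) ≤ (((1 / 2 : ℚ) ^ n : ℚ) : ℝ) := by
      push_cast; linarith
    exact_mod_cast this
  · have h0 : Tendsto (fun n : ℕ => (1 : ℝ) / 2 ^ n) atTop (𝓝 0) := by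
      simpa [one_div_pow] using
        tendsto_pow_atTop_nhds_zero_of_lt_one (r := (1 / 2 : ℝ)) (by norm_num) (by norm_num)
    have : Tendsto (fun n => (q n : ℝ)) atTop (𝓝 x) := by
      rw [tendsto_iff_dist_tendsto_zero]
      exact squeeze_zero (fun _ => dist_nonneg) (fun n => by rw [Real.dist_eq]; exact h n) h0
    exact (tendsto_add_atTop_iff_nat 1).2 this

/-- Computable rational approximations to a function on strings. -/
def HasStringApprox (M : List Bool → ℝ) : Prop :=
  ∃ a : List Bool × ℕ → ℚ, Computable a ∧ ∀ σ n, |(a (σ, n) : ℝ) - M σ| ≤ 1 / 2 ^ n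

theorem IsComputableOnStrings.hasStringApprox {M : List Bool → ℝ} (h : IsComputableOnStrings M) :
    HasStringApprox M := by
  obtain ⟨F, hF, h⟩ := h
  exact ⟨fun p => ratOf (F p), by fun_prop, fun σ n => (h σ).abs_sub_le n⟩

theorem HasStringApprox.isComputableOnStrings {M : List Bool → ℝ} (h : HasStringApprox M) :
    IsComputableOnStrings M := by
  obtain ⟨a, ha, h⟩ := h
  refine ⟨fun p => ((a (p.1, p.2 + 1)).num, (a (p.1, p.2 + 1)).den - 1), by fun_prop, fun σ => ?_⟩
  simp only [ratOf_code]
  exact isCauchyNameFor_of_abs_sub_le (q := fun n => a (σ, n)) (h σ)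

/-- Computable rational approximations to a function on the rationals of `[0, 1]`. -/
def HasRatApprox (G : ℝ → ℝ) : Prop :=
  ∃ g : ℚ × ℕ → ℚ, Computable g ∧
    ∀ q n, 0 ≤ q → q ≤ 1 → |(g (q, n) : ℝ) - G q| ≤ 1 / 2 ^ n

theorem IsComputableOnRationals.hasRatApprox {f : ℝ → ℝ} (h : IsComputableOnRationals f) :
    HasRatApprox f := by
  obtain ⟨F, hF, h⟩ := h
  refine ⟨fun p => ratOf (F ((p.1.num, p.1.den - 1), p.2)), by fun_prop, fun q n h0 h1 => ?_⟩
  have := h (q.num, q.den - 1)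
  rw [ratOf_code] at this
  exact (this ⟨by exact_mod_cast h0, by exact_mod_cast h1⟩).abs_sub_le n

theorem HasRatApprox.isComputableOnRationals {f : ℝ → ℝ} (h : HasRatApprox f) :
    IsComputableOnRationals f := by
  obtain ⟨g, hg, h⟩ := h
  refine ⟨fun p => ((g (ratOf p.1, p.2 + 1)).num, (g (ratOf p.1, p.2 + 1)).den - 1), by fun_prop,
    fun p hp => ?_⟩
  simp only [ratOf_code]
  exact isCauchyNameFor_of_abs_sub_le (q := fun n => g (ratOf p, n)) fun n =>
    h _ n (by exact_mod_cast hp.1) (by exact_mod_cast hp.2)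

theorem HasRatApprox.comp {G : ℝ → ℝ} (hG : HasRatApprox G) {φ : ℚ → ℚ} (hφ : Computable φ)
    (hφ' : ∀ q, 0 ≤ q → q ≤ 1 → 0 ≤ φ q ∧ φ q ≤ 1) {ψ : ℝ → ℝ} (hψ : ∀ q : ℚ, ψ q = φ q) :
    HasRatApprox fun x => G (ψ x) := by
  obtain ⟨g, hg, h⟩ := hG
  refine ⟨fun p => g (φ p.1, p.2), by fun_prop, fun q n h0 h1 => ?_⟩
  simp only [hψ]
  exact h _ n (hφ' q h0 h1).1 (hφ' q h0 h1).2

theorem hasRatApprox_cdf {X : List Bool → ℚ} {K : ℚ} (hc : Computable X) (hX : IsFair X)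
    (hK : HasLinearGrowth X K) : HasRatApprox (cdf X) := by
  obtain ⟨c, hc'⟩ := pow_unbounded_of_one_lt (3 * K : ℝ) (by norm_num : (1 : ℝ) < 2)
  refine ⟨fun p => cdfRat X p.1 (p.2 + c), computable_cdfRat hc (by fun_prop) (by fun_prop),
    fun q n h0 _ => (abs_cdfRat_sub_le hX hK h0 _).trans ?_⟩
  rw [pow_add, div_le_div_iff₀ (by positivity) (by positivity)]
  have := mul_le_mul_of_nonneg_left hc'.le (by positivity : (0 : ℝ) ≤ 2 ^ n)
  linarith

end CauchyNames

/-! ### Dyadic slopes -/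

section Slopes

/-- The average slope of `G` on the dyadic interval coded by `σ`. -/
noncomputable def slopeOn (G : ℝ → ℝ) (σ : List Bool) : ℝ :=
  2 ^ σ.length * (G ((num σ + 1) / 2 ^ σ.length) - G (num σ / 2 ^ σ.length))

theorem slopeOn_fair (G : ℝ → ℝ) (σ : List Bool) :
    slopeOn G (σ ++ [false]) + slopeOn G (σ ++ [true]) = 2 * slopeOn G σ := by
  have e1 : (2 * (num σ : ℝ) + 1 + 1) / 2 ^ (σ.length + 1) = (num σ + 1) / 2 ^ σ.length := by
    rw [pow_succ]; field_simp; ring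
  have e2 : (2 * (num σ : ℝ)) / 2 ^ (σ.length + 1) = num σ / 2 ^ σ.length := by
    rw [pow_succ]; field_simp
  simp only [slopeOn, num_concat, List.length_append, List.length_singleton, Bool.toNat_false,
    Bool.toNat_true]
  push_cast
  rw [add_zero, e1, e2, pow_succ]
  ring

theorem num_div_nonneg (σ : List Bool) : (0 : ℝ) ≤ num σ / 2 ^ σ.length := by positivity

theorem num_add_one_div_le_one (σ : List Bool) : ((num σ : ℝ) + 1) / 2 ^ σ.length ≤ 1 := by
  rw [div_le_one (by positivity)]
  exact_mod_cast num_lt σ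

theorem num_div_le_num_add_one_div (σ : List Bool) :
    (num σ : ℝ) / 2 ^ σ.length ≤ (num σ + 1) / 2 ^ σ.length := by
  gcongr; linarith

theorem HasRatApprox.slopeOn {G : ℝ → ℝ} (hG : HasRatApprox G) :
    HasStringApprox (slopeOn G) := by
  obtain ⟨g, hg, h⟩ := hG
  refine ⟨fun p => 2 ^ p.1.length *
    (g (((num p.1 : ℚ) + ((1 : ℕ) : ℚ)) / 2 ^ p.1.length, p.2 + (p.1.length + 1)) -
      g ((num p.1 : ℚ) / 2 ^ p.1.length, p.2 + (p.1.length + 1))), by fun_prop, fun σ n => ?_⟩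
  have b0 : (0 : ℚ) ≤ num σ / 2 ^ σ.length := by positivity
  have b1 : ((num σ : ℚ) + (1 : ℕ)) / 2 ^ σ.length ≤ 1 := by
    rw [div_le_one (by positivity)]
    exact_mod_cast num_lt σ
  have b2 : (num σ : ℚ) / 2 ^ σ.length ≤ (num σ + (1 : ℕ)) / 2 ^ σ.length := by
    gcongr; simp
  have h1 := h _ (n + (σ.length + 1)) (b0.trans b2) b1
  have h2 := h _ (n + (σ.length + 1)) b0 (b2.trans b1)
  push_cast at h1 h2 ⊢
  rw [CompRandom.slopeOn, ← mul_sub, abs_mul, abs_of_pos (by positivity : (0 : ℝ) < 2 ^ σ.length)]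
  have h3 (a b c d : ℝ) : |a - b - (c - d)| ≤ |a - c| + |b - d| := by
    have := abs_sub (a - c) (b - d)
    rwa [show a - c - (b - d) = a - b - (c - d) by ring] at this
  refine (mul_le_mul_of_nonneg_left ((h3 _ _ _ _).trans (add_le_add h1 h2))
    (by positivity)).trans (le_of_eq ?_)
  rw [pow_add, pow_succ]
  field_simp
  norm_num

end Slopes

/-! ### Binary expansions -/

section Expansions

@[simp] theorem initialSegment_succ (Z : ℕ → Bool) (n : ℕ) :
    initialSegment Z (n + 1) = initialSegment Z n ++ [Z n] := by
  simp [initialSegment, List.range_succ]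

@[simp] theorem length_initialSegment (Z : ℕ → Bool) (n : ℕ) :
    (initialSegment Z n).length = n := by simp [initialSegment]

theorem num_initialSegment_div (Z : ℕ → Bool) (n : ℕ) :
    (num (initialSegment Z n) : ℝ) / 2 ^ n =
      ∑ i ∈ Finset.range n, if Z i = true then (1 / 2 : ℝ) ^ (i + 1) else 0 := by
  induction n with
  | zero => simp [initialSegment]
  | succ n ih =>
    rw [Finset.sum_range_succ, ← ih, initialSegment_succ, num_concat, pow_succ]
    cases Z n
    · simp; field_simp
    · simp; field_simp; ring

theorem IsBinaryExpansion.num_div_le {Z : ℕ → Bool} {z : ℝ} (h : IsBinaryExpansion Z z) (n : ℕ) :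
    (num (initialSegment Z n) : ℝ) / 2 ^ n ≤ z := by
  rw [num_initialSegment_div]
  exact sum_le_hasSum _ (fun i _ => by split_ifs <;> positivity) h

theorem IsBinaryExpansion.le_num_add_one_div {Z : ℕ → Bool} {z : ℝ} (h : IsBinaryExpansion Z z)
    (n : ℕ) : z ≤ (num (initialSegment Z n) + 1) / 2 ^ n := by
  have ha : Antitone fun m => ((num (initialSegment Z m) : ℝ) + 1) / 2 ^ m := by
    refine antitone_nat_of_succ_le fun m => ?_
    have hb : ((Z m).toNat : ℝ) ≤ 1 := by exact_mod_cast (Z m).toNat_le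
    rw [initialSegment_succ, num_concat, pow_succ, div_le_div_iff₀ (by positivity) (by positivity)]
    push_cast
    have := mul_le_mul_of_nonneg_right hb (by positivity : (0 : ℝ) ≤ 2 ^ m)
    linarith
  refine le_of_tendsto h.tendsto_sum_nat ?_
  filter_upwards [eventually_ge_atTop n] with m hm
  refine le_trans ?_ (ha hm)
  rw [← num_initialSegment_div]
  exact div_le_div_of_nonneg_right (by linarith) (by positivity)

/-- The prefix of length `n` of the standard binary expansion of `y`. -/
noncomputable def path (y : ℝ) (n : ℕ) : List Bool := str n ⌊2 ^ n * y⌋₊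

@[simp] theorem length_path (y : ℝ) (n : ℕ) : (path y n).length = n := length_str _ _

theorem path_succ {y : ℝ} (hy : 0 ≤ y) (n : ℕ) :
    path y (n + 1) = path y n ++ [decide (⌊2 ^ (n + 1) * y⌋₊ % 2 = 1)] := by
  rw [path, str, path]
  have : ⌊2 ^ (n + 1) * y⌋₊ / 2 = ⌊2 ^ n * y⌋₊ := by
    rw [pow_succ', mul_assoc]
    rcases natFloor_two_mul (x := 2 ^ n * y) (by positivity) with h | h <;> omega
  rw [this]

theorem num_path {y : ℝ} (hy : 0 ≤ y) (hy1 : y < 1) (n : ℕ) : num (path y n) = ⌊2 ^ n * y⌋₊ := by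
  refine num_str ((Nat.floor_lt (by positivity)).2 ?_)
  push_cast
  exact mul_lt_of_lt_one_right (by positivity) hy1

theorem num_path_div_le {y : ℝ} (hy : 0 ≤ y) (hy1 : y < 1) (n : ℕ) :
    (num (path y n) : ℝ) / 2 ^ n ≤ y := by
  rw [num_path hy hy1, div_le_iff₀ (by positivity), mul_comm y]
  exact Nat.floor_le (by positivity)

theorem lt_num_path_add_one_div {y : ℝ} (hy : 0 ≤ y) (hy1 : y < 1) (n : ℕ) :
    y < (num (path y n) + 1) / 2 ^ n := by
  rw [num_path hy hy1, lt_div_iff₀ (by positivity), mul_comm y]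
  exact Nat.lt_floor_add_one _

theorem exists_isBinaryExpansion {z : ℝ} (hz : z ∈ Set.Icc (0 : ℝ) 1) :
    ∃ Z, IsBinaryExpansion Z z := by
  have key (Z : ℕ → Bool)
      (h : ∀ n, z - (1 / 2) ^ n ≤ (num (initialSegment Z n) : ℝ) / 2 ^ n ∧
        (num (initialSegment Z n) : ℝ) / 2 ^ n ≤ z) : IsBinaryExpansion Z z := by
    rw [IsBinaryExpansion, hasSum_iff_tendsto_nat_of_nonneg (fun i => by split_ifs <;> positivity)]
    simp only [← num_initialSegment_div]
    have h0 := (tendsto_pow_atTop_nhds_zero_of_lt_one (r := (1 / 2 : ℝ)) (by norm_num)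
      (by norm_num)).const_sub z
    rw [sub_zero] at h0
    exact tendsto_of_tendsto_of_tendsto_of_le_of_le h0 tendsto_const_nhds (fun n => (h n).1)
      fun n => (h n).2
  rcases hz.2.lt_or_eq with h1 | rfl
  · refine ⟨fun n => decide (⌊2 ^ (n + 1) * z⌋₊ % 2 = 1), key _ fun n => ?_⟩
    have e : initialSegment (fun n => decide (⌊2 ^ (n + 1) * z⌋₊ % 2 = 1)) n = path z n := by
      induction n with
      | zero => rfl
      | succ n ih => rw [path_succ hz.1, initialSegment_succ, ih]
    rw [e]
    have h3 := lt_num_path_add_one_div hz.1 h1 n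
    rw [add_div, ← one_div_pow] at h3
    exact ⟨by linarith, num_path_div_le hz.1 h1 n⟩
  -- The floor digits fail at `z = 1`, where they are all zero; the expansion `0.111…` is used
  -- instead.
  · have e (n : ℕ) : (num (initialSegment (fun _ => true) n) : ℝ) + 1 = 2 ^ n := by
      induction n with
      | zero => simp [initialSegment]
      | succ n ih =>
        rw [initialSegment_succ, num_concat, pow_succ, ← ih]; push_cast; simp; ring
    refine ⟨fun _ => true, key _ fun n => ?_⟩
    rw [eq_sub_of_add_eq (e n), sub_div, div_self (by positivity), one_div_pow]
    exact ⟨le_rfl, by linarith [show (0 : ℝ) ≤ 1 / 2 ^ n by positivity]⟩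

end Expansions

/-! ### Replacing real martingales by rational ones -/

section RationalMartingales

/-- Approximate values of `M` need not be fair, so the stakes are approximated instead, with error
at most `1 / 2 ^ σ.length`. These errors sum to at most `2 / 2 ^ σ.length` beyond `σ`; with the
initial error at most `1`, the total is at most `3`. The tail estimate makes `R - M` Cauchy along
every path. Signed `M` is allowed, for use with slopes. -/
theorem HasStringApprox.exists_rat_martingale {M : List Bool → ℝ}
    (hM : ∀ σ, M (σ ++ [false]) + M (σ ++ [true]) = 2 * M σ) (ha : HasStringApprox M) :
    ∃ R : List Bool → ℚ, Computable R ∧ IsFair R ∧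
      (∀ σ τ, |((R (σ ++ τ) : ℝ) - M (σ ++ τ)) - (R σ - M σ)| ≤ 2 / 2 ^ σ.length) ∧
      ∀ σ, |(R σ : ℝ) - M σ| ≤ 3 := by
  obtain ⟨a, hac, ha⟩ := ha
  set s : List Bool → ℚ := fun σ =>
    (a (σ ++ [false], σ.length) - a (σ ++ [true], σ.length)) / ((2 : ℕ) : ℚ) with hs
  have hsc : Computable s := by fun_prop
  set R := pathRec (a ([], 0)) (fun σ b x => x + bif b then -s σ else s σ) with hR
  have hRc (σ : List Bool) (b : Bool) : R (σ ++ [b]) = R σ + bif b then -s σ else s σ :=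
    pathRec_concat _ _ _ _
  have hstake (σ : List Bool) : |(s σ : ℝ) - (M (σ ++ [false]) - M (σ ++ [true])) / 2| ≤
      1 / 2 ^ σ.length := by
    have h1 := abs_le.1 (ha (σ ++ [false]) σ.length)
    have h2 := abs_le.1 (ha (σ ++ [true]) σ.length)
    simp only [hs]
    push_cast
    rw [abs_le]
    constructor <;> linarith
  have hstep (σ : List Bool) (b : Bool) :
      |((R (σ ++ [b]) : ℝ) - M (σ ++ [b])) - (R σ - M σ)| ≤ 1 / 2 ^ σ.length := by
    have h1 := abs_le.1 (hstake σ)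
    have h2 := hM σ
    rw [hRc, abs_le]
    cases b
    · simp only [cond_false]; push_cast; constructor <;> linarith
    · simp only [cond_true]; push_cast; constructor <;> linarith
  have hext (σ τ : List Bool) : |((R (σ ++ τ) : ℝ) - M (σ ++ τ)) - (R σ - M σ)| ≤
      2 / 2 ^ σ.length - 2 / 2 ^ (σ.length + τ.length) := by
    induction τ using List.reverseRecOn with
    | nil => simp
    | append_singleton τ b ih =>
      have h1 := hstep (σ ++ τ) b
      have h2 := abs_sub_le ((R (σ ++ τ ++ [b]) : ℝ) - M (σ ++ τ ++ [b]))
        ((R (σ ++ τ) : ℝ) - M (σ ++ τ)) (R σ - M σ)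
      rw [List.length_append] at h1
      have h3 : (2 : ℝ) / 2 ^ (σ.length + (τ.length + 1)) = 1 / 2 ^ (σ.length + τ.length) := by
        rw [← add_assoc, pow_succ]; field_simp
      have h4 : (2 : ℝ) / 2 ^ (σ.length + τ.length) = 1 / 2 ^ (σ.length + τ.length) +
        1 / 2 ^ (σ.length + τ.length) := by ring
      rw [← List.append_assoc, List.length_append, List.length_singleton, h3]
      linarith
  have hRcomp : Computable R := by
    refine computable_pathRec _ ?_
    fun_prop
  refine ⟨R, hRcomp, fun σ => ?_, fun σ τ => (hext σ τ).trans ?_, fun σ => ?_⟩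
  · rw [hRc, hRc]; simp; ring
  · have : (0 : ℝ) ≤ 2 / 2 ^ (σ.length + τ.length) := by positivity
    linarith
  · have h1 := hext [] σ
    have h2 := ha [] 0
    have h3 : (0 : ℝ) ≤ 2 / 2 ^ σ.length := by positivity
    have h4 := abs_sub_le ((R σ : ℝ) - M σ) ((R [] : ℝ) - M []) 0
    have h5 : R [] = a ([], 0) := rfl
    simp only [List.nil_append, List.length_nil, pow_zero, zero_add, sub_zero, div_one] at *
    rw [h5] at h1 h4
    linarith

end RationalMartingales

/-- Truncation of `t` to `[-c, c]`. -/
def clip (c t : ℚ) : ℚ := max (-c) (min c t)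

theorem clip_neg {c : ℚ} (hc : 0 ≤ c) (t : ℚ) : clip c (-t) = -clip c t := by
  simp only [clip, max_def, min_def]
  split_ifs <;> linarith

theorem clip_le {c : ℚ} (hc : 0 ≤ c) (t : ℚ) : clip c t ≤ c :=
  max_le (by linarith) (min_le_left _ _)

theorem neg_le_clip (c t : ℚ) : -c ≤ clip c t := le_max_left _ _

/-- If the upper cap is not reached, truncation can only reduce a loss. -/
theorem le_clip_of_clip_lt {c t : ℚ} (h : clip c t < c) : t ≤ clip c t := by
  have h1 : min c t < c := (le_max_right _ _).trans_lt h
  have h2 : min c t = t := min_eq_right (le_of_lt (by simpa using h1))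
  rw [clip, h2]
  exact le_max_right _ _

@[fun_prop]
theorem computable_clip {α : Type*} [Primcodable α] {f g : α → ℚ} (hf : Computable f)
    (hg : Computable g) : Computable fun a => clip (f a) (g a) := by
  unfold clip
  fun_prop

/-! ### Derivatives as limits of dyadic slopes -/

section Derivative

/-- The linearization errors at the two endpoints are small relative to their distances from `z`,
and these distances add up to the length of the interval. Hence `z` may itself be an endpoint. -/
theorem tendsto_slopeOn {G : ℝ → ℝ} {z d : ℝ} (h : HasDerivWithinAt G d (Set.Icc 0 1) z)
    {σ : ℕ → List Bool} (hl : ∀ n, (σ n).length = n) (h1 : ∀ n, (num (σ n) : ℝ) / 2 ^ n ≤ z)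
    (h2 : ∀ n, z ≤ (num (σ n) + 1) / 2 ^ n) :
    Tendsto (fun n => slopeOn G (σ n)) atTop (𝓝 d) := by
  rw [Metric.tendsto_atTop]
  intro ε hε
  have hb := h.isLittleO.def (half_pos hε)
  rw [eventually_nhdsWithin_iff, Metric.eventually_nhds_iff] at hb
  obtain ⟨δ, hδ, hb⟩ := hb
  obtain ⟨n₀, hn₀⟩ := exists_pow_lt_of_lt_one hδ (by norm_num : (1 / 2 : ℝ) < 1)
  refine ⟨n₀, fun n hn => ?_⟩
  have hlen : (1 / 2 : ℝ) ^ n < δ :=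
    (pow_le_pow_of_le_one (by norm_num) (by norm_num) hn).trans_lt hn₀
  rw [one_div_pow] at hlen
  set a : ℝ := num (σ n) / 2 ^ n with ha
  set b : ℝ := (num (σ n) + 1) / 2 ^ n with hb'
  have hab : b - a = 1 / 2 ^ n := by rw [ha, hb', add_div]; ring
  have h0a : 0 ≤ a := by positivity
  have hb1 : b ≤ 1 := by have := num_add_one_div_le_one (σ n); rwa [hl] at this
  have h1n := h1 n
  have h2n := h2 n
  have ea := hb (y := a) (by rw [Real.dist_eq, abs_lt]; constructor <;> linarith)
    ⟨h0a, by linarith⟩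
  have eb := hb (y := b) (by rw [Real.dist_eq, abs_lt]; constructor <;> linarith)
    ⟨by linarith, hb1⟩
  simp only [Real.norm_eq_abs, smul_eq_mul] at ea eb
  rw [abs_of_nonpos (by linarith : a - z ≤ 0), abs_le] at ea
  rw [abs_of_nonneg (by linarith : 0 ≤ b - z), abs_le] at eb
  have hs : slopeOn G (σ n) = 2 ^ n * (G b - G a) := by rw [slopeOn, hl]
  have hd : slopeOn G (σ n) - d = 2 ^ n * (G b - G a - (b - a) * d) := by
    rw [hs, hab]; field_simp
  have hle : |G b - G a - (b - a) * d| ≤ ε / 2 * (1 / 2 ^ n) := by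
    rw [← hab, abs_le]
    constructor <;> nlinarith
  rw [Real.dist_eq, hd, abs_mul, abs_of_pos (by positivity : (0 : ℝ) < 2 ^ n)]
  calc 2 ^ n * |G b - G a - (b - a) * d| ≤ 2 ^ n * (ε / 2 * (1 / 2 ^ n)) := by gcongr
    _ = ε / 2 := by field_simp
    _ < ε := half_lt_self hε

theorem slopeOn_cdf {X : List Bool → ℚ} (hX : IsFair X) (σ : List Bool) :
    slopeOn (cdf X) σ = X σ := by
  rw [slopeOn, cdf_dyadic_sub hX, str_num]
  field_simp

end Derivative

/-! ### The oscillating strategy -/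

section Oscillation

/-- One step of the oscillating strategy. The state is a position `x` between `-2` and `1` and a
direction; the strategy copies the bets of `R` with capital `x + 2` until `x = 1`, and then turns
around. -/
def oscStep (R : List Bool → ℚ) (σ : List Bool) (b : Bool) (s : ℚ × Bool) : ℚ × Bool :=
  bif ratLE 1 (s.1 + clip (1 - s.1) ((s.1 + 2) * (R (σ ++ [b]) - R σ) / R σ)) then (-1, !s.2)
  else (s.1 + clip (1 - s.1) ((s.1 + 2) * (R (σ ++ [b]) - R σ) / R σ), s.2)

/-- The state of the oscillating strategy. -/
def oscState (R : List Bool → ℚ) : List Bool → ℚ × Bool := pathRec (0, true) (oscStep R)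

/-- The capital of the oscillating strategy. -/
def osc (R : List Bool → ℚ) (σ : List Bool) : ℚ :=
  bif (oscState R σ).2 then (oscState R σ).1 else -(oscState R σ).1

variable {R : List Bool → ℚ}

theorem computable_osc (hR : Computable R) : Computable (osc R) := by
  have : Computable (oscState R) := by
    refine computable_pathRec _ ?_
    unfold oscStep
    fun_prop
  unfold osc
  fun_prop

theorem IsFair.sub_eq_neg {R : List Bool → ℚ} (hR : IsFair R) (σ : List Bool) :
    R (σ ++ [true]) - R σ = -(R (σ ++ [false]) - R σ) := by
  have := hR σ
  linarith

theorem oscState_bounds (h1 : ∀ σ, 1 ≤ R σ) (σ : List Bool) :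
    -2 < (oscState R σ).1 ∧ (oscState R σ).1 < 1 := by
  induction σ using List.reverseRecOn with
  | nil => simp [oscState, pathRec_nil]
  | append_singleton σ b ih =>
    rw [oscState, pathRec_concat, ← oscState, oscStep]
    rcases hb : ratLE 1 ((oscState R σ).1 + clip (1 - (oscState R σ).1)
      (((oscState R σ).1 + 2) * (R (σ ++ [b]) - R σ) / R σ)) with _ | _
    · have hlt := lt_of_not_ge (fun h => by rw [ratLE_iff.2 h] at hb; simp at hb)
      simp only [cond_false]
      refine ⟨?_, hlt⟩
      have hle := le_clip_of_clip_lt (c := 1 - (oscState R σ).1)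
        (t := ((oscState R σ).1 + 2) * (R (σ ++ [b]) - R σ) / R σ) (by linarith)
      have hpos : 0 < R σ := by linarith [h1 σ]
      have : -((oscState R σ).1 + 2) <
          ((oscState R σ).1 + 2) * (R (σ ++ [b]) - R σ) / R σ := by
        rw [lt_div_iff₀ hpos]
        have h3 : 0 < R (σ ++ [b]) := by linarith [h1 (σ ++ [b])]
        have h4 := mul_pos (by linarith : 0 < (oscState R σ).1 + 2) h3
        linarith
      linarith
    · simp

theorem abs_osc_le (h1 : ∀ σ, 1 ≤ R σ) (σ : List Bool) : |osc R σ| ≤ 2 := by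
  have := oscState_bounds h1 σ
  rw [osc, abs_le]
  cases (oscState R σ).2 <;> simp <;> constructor <;> linarith

/-- A turn replaces position `1` by position `-1` in the opposite direction, which denotes the same
capital. Thus one formula covers both cases. -/
theorem osc_concat (h1 : ∀ σ, 1 ≤ R σ) (σ : List Bool) (b : Bool) :
    osc R (σ ++ [b]) = (bif (oscState R σ).2 then 1 else -1) * ((oscState R σ).1 +
      clip (1 - (oscState R σ).1) (((oscState R σ).1 + 2) * (R (σ ++ [b]) - R σ) / R σ)) := by
  have hx := oscState_bounds h1 σ
  have hc := clip_le (c := 1 - (oscState R σ).1) (by linarith)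
    (((oscState R σ).1 + 2) * (R (σ ++ [b]) - R σ) / R σ)
  rw [osc, oscState, pathRec_concat, ← oscState, oscStep]
  rcases hb : ratLE 1 ((oscState R σ).1 + clip (1 - (oscState R σ).1)
      (((oscState R σ).1 + 2) * (R (σ ++ [b]) - R σ) / R σ)) with _ | _
  · cases (oscState R σ).2 <;> simp
  · have := ratLE_iff.1 hb
    have e : (oscState R σ).1 + clip (1 - (oscState R σ).1)
      (((oscState R σ).1 + 2) * (R (σ ++ [b]) - R σ) / R σ) = 1 := by linarith
    rw [e]
    cases (oscState R σ).2 <;> simp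

/-- The two children of `σ` move by opposite amounts because the truncation is symmetric: the loss
is capped together with the win. -/
theorem isFair_osc (hR : IsFair R) (h1 : ∀ σ, 1 ≤ R σ) : IsFair (osc R) := by
  intro σ
  have hx := oscState_bounds h1 σ
  rw [osc_concat h1, osc_concat h1, hR.sub_eq_neg, mul_neg, neg_div, clip_neg (by linarith), osc]
  cases (oscState R σ).2 <;> simp <;> ring

theorem oscState_turn (σ : List Bool) (b : Bool)
    (h : (oscState R (σ ++ [b])).2 ≠ (oscState R σ).2) : (oscState R (σ ++ [b])).1 = -1 := by
  rw [oscState, pathRec_concat, ← oscState, oscStep] at h ⊢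
  cases hb : ratLE 1 ((oscState R σ).1 + clip (1 - (oscState R σ).1)
      (((oscState R σ).1 + 2) * (R (σ ++ [b]) - R σ) / R σ))
  · rw [hb] at h; simp at h
  · simp

/-- Until a turn, the ratio of `x + 2` to `R` never decreases: the relative bets are copied exactly,
except that a loss may be truncated. A win that reaches the cap causes a turn. -/
theorem oscState_growth (h1 : ∀ σ, 1 ≤ R σ) (σ : List Bool) (b : Bool)
    (h : (oscState R (σ ++ [b])).2 = (oscState R σ).2) :
    ((oscState R σ).1 + 2) * R (σ ++ [b]) ≤ ((oscState R (σ ++ [b])).1 + 2) * R σ := by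
  rw [oscState, pathRec_concat, ← oscState, oscStep] at h ⊢
  cases hb : ratLE 1 ((oscState R σ).1 + clip (1 - (oscState R σ).1)
      (((oscState R σ).1 + 2) * (R (σ ++ [b]) - R σ) / R σ))
  · have hlt := lt_of_not_ge (fun h => by rw [ratLE_iff.2 h] at hb; simp at hb)
    simp only [cond_false]
    have hle := le_clip_of_clip_lt (c := 1 - (oscState R σ).1)
        (t := ((oscState R σ).1 + 2) * (R (σ ++ [b]) - R σ) / R σ) (by linarith)
    have hpos : 0 < R σ := by linarith [h1 σ]
    rw [div_le_iff₀ hpos] at hle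
    linarith
  · rw [hb] at h; simp at h

/-- Without a further turn, `x + 2 < 3` would bound `R` along the path by `oscState_growth`. -/
theorem exists_oscState_ne (h1 : ∀ σ, 1 ≤ R σ) {Z : ℕ → Bool}
    (hZ : ∀ C, ∃ n, C < R (initialSegment Z n)) (n₀ : ℕ) :
    ∃ n, n₀ < n ∧ (oscState R (initialSegment Z n)).2 = !(oscState R (initialSegment Z n₀)).2 ∧
      (oscState R (initialSegment Z n)).1 = -1 := by
  have hpos (σ : List Bool) : 0 < R σ := by linarith [h1 σ]
  have hex : ∃ k, (oscState R (initialSegment Z (n₀ + k))).2 ≠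
      (oscState R (initialSegment Z n₀)).2 := by
    by_contra! hno
    set x₀ := (oscState R (initialSegment Z n₀)).1 with hx₀
    have hg (k : ℕ) : (x₀ + 2) * R (initialSegment Z (n₀ + k)) ≤
        ((oscState R (initialSegment Z (n₀ + k))).1 + 2) * R (initialSegment Z n₀) := by
      induction k with
      | zero => simp [hx₀]
      | succ k ih =>
        have hs := oscState_growth h1 (initialSegment Z (n₀ + k)) (Z (n₀ + k)) (by
          rw [← initialSegment_succ, hno, add_assoc, hno])
        rw [← initialSegment_succ, add_assoc] at hs
        have e1 := mul_le_mul_of_nonneg_right ih (hpos (initialSegment Z (n₀ + (k + 1)))).le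
        have e2 := mul_le_mul_of_nonneg_left hs (hpos (initialSegment Z n₀)).le
        refine le_of_mul_le_mul_right ?_ (hpos (initialSegment Z (n₀ + k)))
        linarith
    have hx := (oscState_bounds h1 (initialSegment Z n₀)).1
    have hb (k : ℕ) : R (initialSegment Z (n₀ + k)) ≤
        3 * R (initialSegment Z n₀) / (x₀ + 2) := by
      rw [le_div_iff₀ (by linarith)]
      have e1 := (oscState_bounds h1 (initialSegment Z (n₀ + k))).2
      have e2 := mul_le_mul_of_nonneg_right (by linarith :
        (oscState R (initialSegment Z (n₀ + k))).1 + 2 ≤ 3) (hpos (initialSegment Z n₀)).le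
      linarith [hg k]
    -- The sum rules out an index below `n₀`, to which the bound `hb` does not apply.
    obtain ⟨n, hn⟩ := hZ (3 * R (initialSegment Z n₀) / (x₀ + 2) +
      ∑ i ∈ Finset.range n₀, R (initialSegment Z i))
    rcases lt_or_ge n n₀ with h | h
    · have e1 := Finset.single_le_sum (f := fun i => R (initialSegment Z i))
        (fun i _ => (hpos _).le) (Finset.mem_range.2 h)
      have e2 : 0 ≤ 3 * R (initialSegment Z n₀) / (x₀ + 2) :=
        div_nonneg (mul_nonneg (by norm_num) (hpos _).le) (by linarith)
      linarith
    · obtain ⟨k, rfl⟩ := Nat.exists_eq_add_of_le h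
      have e1 := hb k
      have e2 : 0 ≤ ∑ i ∈ Finset.range n₀, R (initialSegment Z i) :=
        Finset.sum_nonneg fun i _ => (hpos _).le
      linarith
  classical
  have hk := Nat.find_spec hex
  have hk0 : Nat.find hex ≠ 0 := fun h => by rw [h] at hk; simp at hk
  obtain ⟨k, hk'⟩ := Nat.exists_eq_succ_of_ne_zero hk0
  have hmin : (oscState R (initialSegment Z (n₀ + k))).2 =
      (oscState R (initialSegment Z n₀)).2 := by
    by_contra hne
    have := Nat.find_min' hex hne
    omega
  rw [hk', Nat.succ_eq_add_one, ← add_assoc] at hk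
  refine ⟨n₀ + k + 1, by omega, ?_, ?_⟩
  · revert hk
    cases (oscState R (initialSegment Z (n₀ + k + 1))).2 <;>
      cases (oscState R (initialSegment Z n₀)).2 <;> simp
  · rw [initialSegment_succ]
    refine oscState_turn _ _ ?_
    rw [← initialSegment_succ, hmin]
    exact hk

theorem exists_osc_eq (h1 : ∀ σ, 1 ≤ R σ) {Z : ℕ → Bool}
    (hZ : ∀ C, ∃ n, C < R (initialSegment Z n)) (n₀ : ℕ) :
    (∃ n, n₀ ≤ n ∧ osc R (initialSegment Z n) = 1) ∧
      ∃ n, n₀ ≤ n ∧ osc R (initialSegment Z n) = -1 := by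
  obtain ⟨n, hn, hs, hx⟩ := exists_oscState_ne h1 hZ n₀
  obtain ⟨m, hm, hs', hx'⟩ := exists_oscState_ne h1 hZ n
  cases h : (oscState R (initialSegment Z n₀)).2
  · refine ⟨⟨m, by omega, ?_⟩, n, by omega, ?_⟩ <;> simp [osc, hs', hs, hx, hx', h]
  · refine ⟨⟨n, by omega, ?_⟩, m, by omega, ?_⟩ <;> simp [osc, hs', hs, hx, hx', h]

end Oscillation

/-! ### Nondifferentiability at points that are not computably random -/

theorem lipschitzOnWith_cdf {X : List Bool → ℚ} {C : ℚ} (hX : IsFair X) (hC : ∀ σ, |X σ| ≤ C) :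
    LipschitzOnWith (C : ℝ).toNNReal (cdf X) (Set.Icc 0 1) := by
  have hC0 : (0 : ℝ) ≤ C := by exact_mod_cast (abs_nonneg _).trans (hC [])
  refine LipschitzOnWith.of_dist_le_mul fun x hx y hy => ?_
  rw [Real.dist_eq, Real.dist_eq, Real.coe_toNNReal _ hC0]
  exact abs_cdf_sub_le hX hC hx.1 hy.1

theorem isEffectivelyUniformlyContinuous_of_lipschitz {f : ℝ → ℝ} {c : NNReal}
    (hf : LipschitzOnWith c f (Set.Icc 0 1)) : IsEffectivelyUniformlyContinuous f := by
  obtain ⟨k, hk⟩ := pow_unbounded_of_one_lt (c : ℝ) (by norm_num : (1 : ℝ) < 2)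
  refine ⟨fun n => n + k, by fun_prop, fun n x hx y hy hxy => ?_⟩
  have h1 := hf.dist_le_mul x hx y hy
  rw [Real.dist_eq, Real.dist_eq] at h1
  have h2 : (2 : ℝ) ^ k * |x - y| < 2 ^ k * (1 / 2) ^ (n + k) := by gcongr
  have h3 : (2 : ℝ) ^ k * (1 / 2) ^ (n + k) = (1 / 2) ^ n := by
    rw [one_div_pow, one_div_pow, pow_add]; field_simp
  have h4 := mul_le_mul_of_nonneg_right hk.le (abs_nonneg (x - y))
  linarith

theorem exists_not_differentiableWithinAt {z : ℝ} (hz : z ∈ Set.Icc (0 : ℝ) 1)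
    (h : ¬ IsComputablyRandom z) :
    ∃ f : ℝ → ℝ, IsComputableOnUnitInterval f ∧
      (∃ c : NNReal, LipschitzOnWith c f (Set.Icc (0 : ℝ) 1)) ∧
      ¬ DifferentiableWithinAt ℝ f (Set.Icc (0 : ℝ) 1) z := by
  obtain ⟨Z, hZ⟩ := exists_isBinaryExpansion hz
  have hZ' : ¬ IsComputablyRandomSeq Z := fun h' => h ⟨Z, hZ, h'⟩
  simp only [IsComputablyRandomSeq, not_forall, not_not] at hZ'
  obtain ⟨M, hM, hMc, hMs⟩ := hZ'
  obtain ⟨R₀, hR₀, hR₀f, -, hR₀M⟩ := hMc.hasStringApprox.exists_rat_martingale hM.2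
  -- The error of `R₀` is at most `3`; one more unit makes `R ≥ 1`.
  set R : List Bool → ℚ := fun σ => R₀ σ + 4 with hR
  have hRc : Computable R := by fun_prop
  have hRf : IsFair R := fun σ => by simp only [hR]; linarith [hR₀f σ]
  have hR1 (σ : List Bool) : 1 ≤ R σ := by
    have h1 := abs_le.1 (hR₀M σ)
    have h2 := hM.1 σ
    have h3 : ((1 : ℚ) : ℝ) ≤ ((R₀ σ + 4 : ℚ) : ℝ) := by push_cast; linarith
    exact_mod_cast h3
  have hRu (C : ℚ) : ∃ n, C < R (initialSegment Z n) := by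
    by_contra! hno
    refine hMs ⟨C, ?_⟩
    rintro _ ⟨n, rfl⟩
    have h1 := abs_le.1 (hR₀M (initialSegment Z n))
    have h3 : ((R₀ (initialSegment Z n) + 4 : ℚ) : ℝ) ≤ C := by exact_mod_cast hno n
    push_cast at h3
    simp only
    linarith
  have hNf := isFair_osc hRf hR1
  have hNb := abs_osc_le hR1
  have hlip := lipschitzOnWith_cdf hNf hNb
  refine ⟨cdf (osc R), ⟨?_, isEffectivelyUniformlyContinuous_of_lipschitz hlip⟩, ⟨_, hlip⟩, ?_⟩
  · refine (hasRatApprox_cdf (K := 2) (computable_osc hRc) hNf fun σ => ?_).isComputableOnRationals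
    have := hNb σ
    have h2 : (0 : ℚ) ≤ 2 * σ.length := by positivity
    linarith
  · intro hd
    have ht := tendsto_slopeOn hd.hasDerivWithinAt (length_initialSegment Z) hZ.num_div_le
      hZ.le_num_add_one_div
    simp only [slopeOn_cdf hNf] at ht
    rw [Metric.tendsto_atTop] at ht
    obtain ⟨n₀, hn₀⟩ := ht 1 one_pos
    obtain ⟨⟨n, hn, e1⟩, m, hm, e2⟩ := exists_osc_eq hR1 hRu n₀
    have h1 := hn₀ n hn
    have h2 := hn₀ m hm
    rw [e1, Real.dist_eq, abs_lt] at h1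
    rw [e2, Real.dist_eq, abs_lt] at h2
    push_cast at h1 h2
    linarith

/-! ### Monotone functions, savings and shifted random points -/

theorem IsComputablyRandomSeq.bddAbove_slopeOn {Z : ℕ → Bool} (hZ : IsComputablyRandomSeq Z)
    {G : ℝ → ℝ} (hG : MonotoneOn G (Set.Icc 0 1)) (ha : HasRatApprox G) :
    BddAbove (Set.range fun n => slopeOn G (initialSegment Z n)) := by
  have h0 (σ : List Bool) : 0 ≤ slopeOn G σ := by
    have h1 := num_div_nonneg σ
    have h2 := num_div_le_num_add_one_div σ
    have h3 := num_add_one_div_le_one σ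
    exact mul_nonneg (by positivity)
      (sub_nonneg.2 (hG ⟨h1, h2.trans h3⟩ ⟨h1.trans h2, h3⟩ h2))
  exact not_not.1 (hZ (slopeOn G) ⟨h0, slopeOn_fair G⟩ ha.slopeOn.isComputableOnStrings)

theorem IsComputablyRandomSeq.ne_rat {Z : ℕ → Bool} (hZ : IsComputablyRandomSeq Z) {z : ℝ}
    (hz : IsBinaryExpansion Z z) (q : ℚ) : z ≠ q := by
  intro hzq
  -- The middle value at `q` makes `G` rise by at least `1` across every nondegenerate closed
  -- interval containing `q`, even one ending there.
  set G : ℝ → ℝ := fun x => if x < q then -1 else if x ≤ q then 0 else 1 with hG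
  have hmono : Monotone G := by
    intro x y hxy
    simp only [hG]
    split_ifs <;> linarith
  have happ : HasRatApprox G := by
    refine ⟨fun p => bif ratLE q p.1 then (bif ratLE p.1 q then 0 else 1) else -1, by fun_prop,
      fun p n _ _ => ?_⟩
    have e : (((bif ratLE q p then (bif ratLE p q then 0 else 1) else -1 : ℚ) : ℚ) : ℝ) = G p := by
      simp only [hG]
      rcases lt_trichotomy p q with h | h | h
      · have h1 : ratLE q p = false := Bool.eq_false_iff.2 fun h' => not_le.2 h (ratLE_iff.1 h')
        simp [h1, h]
      · simp [h, ratLE_iff.2 le_rfl]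
      · have h1 : ratLE p q = false := Bool.eq_false_iff.2 fun h' => not_le.2 h (ratLE_iff.1 h')
        have h2 : ratLE q p = true := ratLE_iff.2 h.le
        simp [h1, h2, not_lt.2 h.le, not_le.2 h]
    simp only [e, sub_self, abs_zero]
    positivity
  obtain ⟨C, hC⟩ := hZ.bddAbove_slopeOn (hmono.monotoneOn _) happ
  obtain ⟨n, hn⟩ := pow_unbounded_of_one_lt C (by norm_num : (1 : ℝ) < 2)
  have h1 := hC ⟨n, rfl⟩
  have ha := hz.num_div_le n
  have hb := hz.le_num_add_one_div n
  have hab : (num (initialSegment Z n) : ℝ) / 2 ^ n < (num (initialSegment Z n) + 1) / 2 ^ n := by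
    gcongr; linarith
  have h2 : 1 ≤ G ((num (initialSegment Z n) + 1) / 2 ^ n) - G (num (initialSegment Z n) / 2 ^ n) := by
    rw [hzq] at ha hb
    simp only [hG]
    split_ifs <;> linarith
  have h3 := mul_le_mul_of_nonneg_left h2 (by positivity : (0 : ℝ) ≤ 2 ^ n)
  simp only [slopeOn, length_initialSegment] at h1
  linarith

/-- A martingale that never loses more than `c` from its current capital. -/
def HasSavings (X : List Bool → ℚ) (c : ℚ) : Prop := ∀ σ τ, X σ - c ≤ X (σ ++ τ)

/-- By fairness, a step that cannot lose more than `c` cannot win more than `c` either. -/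
theorem HasSavings.hasLinearGrowth {X : List Bool → ℚ} {c : ℚ} (hX : IsFair X) (h0 : ∀ σ, 0 ≤ X σ)
    (h : HasSavings X c) : HasLinearGrowth X (X [] + c) := by
  intro σ
  rw [abs_of_nonneg (h0 σ)]
  have hc : 0 ≤ c := by simpa using h [] []
  have : X σ ≤ X [] + c * σ.length := by
    induction σ using List.reverseRecOn with
    | nil => simp
    | append_singleton σ b ih =>
      have h1 := h σ [false]
      have h2 := h σ [true]
      have h3 := hX σ
      have h4 : X (σ ++ [b]) ≤ X σ + c := by cases b <;> linarith
      simp only [List.length_append, List.length_singleton]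
      push_cast
      linarith
  have h5 := mul_nonneg (h0 []) (by positivity : (0 : ℚ) ≤ σ.length)
  linarith

/-- All finer dyadic intervals inside the given one have density at least `X (str n N) - c`. The
slope bound therefore holds on arbitrary subintervals, not only dyadic ones. -/
theorem HasSavings.le_cdf_sub {X : List Bool → ℚ} {c : ℚ} (hX : IsFair X) (h0 : ∀ σ, 0 ≤ X σ)
    (h : HasSavings X c) (n N : ℕ) {u v : ℝ} (hu : (N : ℝ) / 2 ^ n ≤ u) (huv : u ≤ v)
    (hv : v ≤ (N + 1) / 2 ^ n) : (X (str n N) - c) * (v - u) ≤ cdf X v - cdf X u := by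
  have hu0 : 0 ≤ u := le_trans (by positivity) hu
  have := le_mul_cdf_sub hX (h.hasLinearGrowth hX h0) hu0 huv (s := 1) (c := X (str n N) - c) n
    fun m hm j hj1 hj2 => by
      obtain ⟨k, rfl⟩ := Nat.exists_eq_add_of_le hm
      have h1 : 2 ^ k * N ≤ j := by
        refine le_trans (Nat.le_floor ?_) hj1
        rw [div_le_iff₀ (by positivity)] at hu
        push_cast
        rw [pow_add]
        have := mul_le_mul_of_nonneg_left hu (by positivity : (0 : ℝ) ≤ 2 ^ k)
        linarith
      have h2 : j < 2 ^ k * N + 2 ^ k := by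
        refine lt_of_lt_of_le hj2 (Nat.floor_le_of_le ?_)
        rw [le_div_iff₀ (by positivity)] at hv
        push_cast
        rw [pow_add]
        have := mul_le_mul_of_nonneg_left hv (by positivity : (0 : ℝ) ≤ 2 ^ k)
        linarith
      obtain ⟨i, rfl⟩ := Nat.exists_eq_add_of_le h1
      rw [str_add n k N (by omega), one_mul]
      exact h _ _
  push_cast at this
  linarith

/-- Pulling `cdf X` back along `x ↦ (x + θ) / 2` gives a computable nondecreasing function, whose
slopes along `Z` are bounded. A large value of `X` on the path would force a large slope on every
small interval around `z`, aligned with the shifted grid or not. -/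
theorem HasSavings.exists_le_path {Z : ℕ → Bool} (hZ : IsComputablyRandomSeq Z) {z : ℝ}
    (hz : IsBinaryExpansion Z z) {θ : ℚ} (hθ0 : 0 ≤ θ) (hθ1 : θ ≤ 1) {X : List Bool → ℚ} {c : ℚ}
    (hc : Computable X) (hX : IsFair X) (h0 : ∀ σ, 0 ≤ X σ) (h : HasSavings X c) :
    ∃ C, ∀ n, X (path ((z + θ) / 2) n) ≤ C := by
  have hθ0' : (0 : ℝ) ≤ θ := by exact_mod_cast hθ0
  have hθ1' : (θ : ℝ) ≤ 1 := by exact_mod_cast hθ1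
  have hz0 : 0 ≤ z := by simpa [initialSegment] using hz.num_div_le 0
  have hz1 : z ≤ 1 := by simpa [initialSegment] using hz.le_num_add_one_div 0
  have hz1' : z < 1 := lt_of_le_of_ne hz1 (by simpa using hZ.ne_rat hz 1)
  set y := (z + θ) / 2 with hy
  have hy0 : 0 ≤ y := by positivity
  have hy1 : y < 1 := by rw [hy]; linarith
  set G : ℝ → ℝ := fun x => cdf X ((x + θ) / 2) with hG
  have hGm : MonotoneOn G (Set.Icc 0 1) := by
    intro a ha b hb hab
    refine cdf_mono hX (h.hasLinearGrowth hX h0) h0 ?_ (by linarith)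
    have := ha.1
    positivity
  have hGa : HasRatApprox G := by
    refine (hasRatApprox_cdf hc hX (h.hasLinearGrowth hX h0)).comp (φ := fun q => (q + θ) / 2)
      (by fun_prop) (fun q h0 h1 => ⟨by positivity, by linarith⟩) fun q => by push_cast; rfl
  obtain ⟨C, hC⟩ := hZ.bddAbove_slopeOn hGm hGa
  -- The factor `2` undoes the halving in the substitution, and `c` is the possible loss.
  obtain ⟨C', hC'⟩ := exists_rat_gt (2 * C + c)
  refine ⟨C', fun n => ?_⟩
  by_contra! hn
  have ha := num_path_div_le hy0 hy1 n
  have hb := lt_num_path_add_one_div hy0 hy1 n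
  -- As `z` is irrational, `y` is interior to its dyadic interval, which thus contains the images of
  -- all sufficiently short dyadic intervals around `z`.
  have ha' : (num (path y n) : ℝ) / 2 ^ n < y := by
    refine lt_of_le_of_ne ha fun he => ?_
    refine hZ.ne_rat hz (2 * (num (path y n) / 2 ^ n) - θ) ?_
    push_cast
    rw [he, hy]
    ring
  obtain ⟨m, hm⟩ := exists_pow_lt_of_lt_one
    (lt_min (sub_pos.2 ha') (sub_pos.2 hb)) (by norm_num : (1 / 2 : ℝ) < 1)
  rw [one_div_pow, lt_min_iff] at hm
  set a := (num (initialSegment Z m) : ℝ) / 2 ^ m with hau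
  set b := ((num (initialSegment Z m) : ℝ) + 1) / 2 ^ m with hbv
  have hab : b - a = 1 / 2 ^ m := by rw [hau, hbv, add_div]; ring
  have hp : (0 : ℝ) < 1 / 2 ^ m := by positivity
  have e1 := hz.num_div_le m
  have e2 := hz.le_num_add_one_div m
  have hle := h.le_cdf_sub hX h0 n (num (path y n)) (u := (a + θ) / 2) (v := (b + θ) / 2)
    (by linarith) (by linarith) (by linarith)
  have hs := hC ⟨m, rfl⟩
  have hstr : str n (num (path y n)) = path y n := by
    conv_rhs => rw [← str_num (path y n), length_path]
  rw [hstr] at hle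
  simp only [slopeOn, length_initialSegment, hG] at hs
  rw [← hau, ← hbv] at hs
  have hn' : (C' : ℝ) < X (path y n) := by exact_mod_cast hn
  have e3 : (b + θ) / 2 - (a + θ) / 2 = 1 / 2 ^ m / 2 := by rw [← hab]; ring
  rw [e3] at hle
  have e4 := mul_le_mul_of_nonneg_left hle (by positivity : (0 : ℝ) ≤ 2 ^ m)
  have e5 : (2 : ℝ) ^ m * ((X (path y n) - c) * (1 / 2 ^ m / 2)) = (X (path y n) - c) / 2 := by
    field_simp
  rw [e5] at e4
  linarith

/-- A nested sequence of strings along which no computable martingale with savings is unbounded. -/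
def IsRandomPath (p : ℕ → List Bool) : Prop :=
  (∀ n, ∃ b, p (n + 1) = p n ++ [b]) ∧
    ∀ (X : List Bool → ℚ) (c : ℚ), Computable X → IsFair X → (∀ σ, 0 ≤ X σ) → HasSavings X c →
      ∃ C, ∀ n, X (p n) ≤ C

theorem IsComputablyRandomSeq.isRandomPath {Z : ℕ → Bool} (hZ : IsComputablyRandomSeq Z) {z : ℝ}
    (hz : IsBinaryExpansion Z z) (hz0 : 0 ≤ z) {θ : ℚ} (hθ0 : 0 ≤ θ) (hθ1 : θ ≤ 1) :
    IsRandomPath (path ((z + θ) / 2)) := by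
  have hθ0' : (0 : ℝ) ≤ θ := by exact_mod_cast hθ0
  exact ⟨fun n => ⟨_, path_succ (by positivity) n⟩, fun X c hc hX h0 h =>
    h.exists_le_path hZ hz hθ0 hθ1 hc hX h0⟩

/-- The sum `Φ + B` can only fall when the bounded potential `Φ` does, by at most `c`. It is thus a
martingale with savings, so it is bounded along `p`, and so is `B`. -/
theorem IsRandomPath.exists_le {p : ℕ → List Bool} (hp : IsRandomPath p) {Φ B : List Bool → ℚ}
    {c : ℚ} (hΦc : Computable Φ) (hBc : Computable B) (hf : IsFair fun σ => Φ σ + B σ)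
    (hΦ0 : ∀ σ, 0 ≤ Φ σ) (hΦ : ∀ σ, Φ σ ≤ c) (hB0 : 0 ≤ B []) (hB : ∀ σ b, B σ ≤ B (σ ++ [b])) :
    ∃ C, ∀ n, B (p n) ≤ C := by
  have hB' (σ τ : List Bool) : B σ ≤ B (σ ++ τ) := by
    induction τ using List.reverseRecOn with
    | nil => simp
    | append_singleton τ b ih =>
      rw [← List.append_assoc]
      exact ih.trans (hB _ _)
  obtain ⟨C, hC⟩ := hp.2 (fun σ => Φ σ + B σ) c (by fun_prop) hf
    (fun σ => add_nonneg (hΦ0 σ) (hB0.trans (by simpa using hB' [] σ))) fun σ τ => by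
      have h1 := hΦ σ
      have h2 := hΦ0 (σ ++ τ)
      have h3 := hB' σ τ
      linarith
  exact ⟨C, fun n => by have h1 := hC n; have h2 := hΦ0 (p n); linarith⟩

theorem summable_of_le_increments {p : ℕ → List Bool} {B : List Bool → ℚ}
    (h : ∃ C, ∀ n, B (p n) ≤ C) {q : ℕ → ℝ} (hq0 : ∀ n, 0 ≤ q n)
    (hq : ∀ n, q n ≤ B (p (n + 1)) - B (p n)) : Summable q := by
  obtain ⟨C, hC⟩ := h
  refine summable_of_sum_range_le (c := C - B (p 0)) hq0 fun n => ?_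
  have h1 : ∑ i ∈ Finset.range n, q i ≤ B (p n) - B (p 0) := by
    induction n with
    | zero => simp
    | succ n ih =>
      rw [Finset.sum_range_succ]
      linarith [hq n]
  have h2 : (B (p n) : ℝ) ≤ C := by exact_mod_cast hC n
  linarith

/-! ### Vanishing increments of bounded martingales -/

section Energy

/-- On average the potential drops by `Q`, so adding the `Q` already spent makes it fair. Hence `Q`
is summable along the path. -/
theorem IsRandomPath.tendsto_zero {p : ℕ → List Bool} (hp : IsRandomPath p)
    {Φ Q : List Bool → ℚ} {c : ℚ} (hΦc : Computable Φ) (hQc : Computable Q)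
    (h : ∀ σ, Φ (σ ++ [false]) + Φ (σ ++ [true]) = 2 * (Φ σ - Q σ))
    (hΦ0 : ∀ σ, 0 ≤ Φ σ) (hΦ : ∀ σ, Φ σ ≤ c) (hQ : ∀ σ, 0 ≤ Q σ) :
    Tendsto (fun n => (Q (p n) : ℝ)) atTop (𝓝 0) := by
  set B := pathRec 0 (fun σ _ a => a + Q σ) with hB
  have hBs (σ : List Bool) (b : Bool) : B (σ ++ [b]) = B σ + Q σ := pathRec_concat _ _ _ _
  have hBc : Computable B := computable_pathRec _ (by fun_prop)
  have hex := hp.exists_le hΦc hBc (fun σ => by simp only [hBs]; linarith [h σ]) hΦ0 hΦ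
    (by rw [hB, pathRec_nil]) fun σ b => by rw [hBs]; linarith [hQ σ]
  refine (summable_of_le_increments hex (fun n => by exact_mod_cast hQ (p n)) fun n => ?_).tendsto_atTop_zero
  obtain ⟨b, hb⟩ := hp.1 n
  rw [hb, hBs]
  push_cast
  linarith

/-- Averaging `Φ` and `Q` over the two children preserves the hypotheses and looks one bit off the
path; each child's `Q` is at most twice the average. -/
theorem IsRandomPath.tendsto_zero_append {p : ℕ → List Bool} (hp : IsRandomPath p)
    {Φ Q : List Bool → ℚ} {c : ℚ} (hΦc : Computable Φ) (hQc : Computable Q)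
    (h : ∀ σ, Φ (σ ++ [false]) + Φ (σ ++ [true]) = 2 * (Φ σ - Q σ))
    (hΦ0 : ∀ σ, 0 ≤ Φ σ) (hΦ : ∀ σ, Φ σ ≤ c) (hQ : ∀ σ, 0 ≤ Q σ) (τ : List Bool) :
    Tendsto (fun n => (Q (p n ++ τ) : ℝ)) atTop (𝓝 0) := by
  induction τ using List.reverseRecOn generalizing Φ Q with
  | nil => simpa using hp.tendsto_zero hΦc hQc h hΦ0 hΦ hQ
  | append_singleton τ b ih =>
    have := ih (Φ := fun σ => (Φ (σ ++ [false]) + Φ (σ ++ [true])) / ((2 : ℕ) : ℚ))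
      (Q := fun σ => (Q (σ ++ [false]) + Q (σ ++ [true])) / ((2 : ℕ) : ℚ)) (by fun_prop)
      (by fun_prop) (fun σ => by
        push_cast
        linarith [h (σ ++ [false]), h (σ ++ [true])])
      (fun σ => by have h1 := hΦ0 (σ ++ [false]); have h2 := hΦ0 (σ ++ [true]); positivity)
      (fun σ => by
        push_cast
        linarith [hΦ (σ ++ [false]), hΦ (σ ++ [true])])
      (fun σ => by have h1 := hQ (σ ++ [false]); have h2 := hQ (σ ++ [true]); positivity)
    have h2 := this.const_mul 2
    rw [mul_zero] at h2
    refine squeeze_zero (fun n => by exact_mod_cast hQ _) (fun n => ?_) h2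
    have h3 := hQ (p n ++ τ ++ [false])
    have h4 := hQ (p n ++ τ ++ [true])
    have h5 : Q (p n ++ (τ ++ [b])) ≤ 2 * ((Q (p n ++ τ ++ [false]) + Q (p n ++ τ ++ [true])) /
      ((2 : ℕ) : ℚ)) := by
      rw [← List.append_assoc]
      push_cast
      cases b <;> linarith
    exact_mod_cast h5

/-- For fair `R`, the average of `R²` over the children exceeds `R²` by the squared increment, so
`C² - R²` is the potential. The two children have opposite increments, and a telescoping sum reaches
any fixed `τ`. -/
theorem IsRandomPath.tendsto_append_sub {p : ℕ → List Bool} (hp : IsRandomPath p)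
    {R : List Bool → ℚ} {C : ℚ} (hc : Computable R) (hR : IsFair R) (hC : ∀ σ, |R σ| ≤ C)
    (τ : List Bool) : Tendsto (fun n => (R (p n ++ τ) : ℝ) - R (p n)) atTop (𝓝 0) := by
  have hstep (τ : List Bool) (b : Bool) :
      Tendsto (fun n => (R (p n ++ (τ ++ [b])) : ℝ) - R (p n ++ τ)) atTop (𝓝 0) := by
    have h := hp.tendsto_zero_append (Φ := fun σ => C * C - R σ * R σ) (Q := fun σ =>
      (R (σ ++ [false]) - R σ) * (R (σ ++ [false]) - R σ)) (c := C * C) (by fun_prop)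
      (by fun_prop) (fun σ => by
        have e : R (σ ++ [true]) = 2 * R σ - R (σ ++ [false]) := by linarith [hR σ]
        rw [e]
        ring)
      (fun σ => by
        have := abs_le_abs (hC σ) (by have := abs_nonneg (R σ); linarith [hC σ])
        rw [abs_abs] at this
        have := abs_le_iff_mul_self_le.1 this
        linarith)
      (fun σ => by linarith [mul_self_nonneg (R σ)]) (fun σ => mul_self_nonneg _) τ
    have h2 := h.sqrt
    rw [Real.sqrt_zero] at h2
    refine (tendsto_zero_iff_abs_tendsto_zero _).2 (h2.congr fun n => ?_)
    push_cast
    rw [Real.sqrt_mul_self_eq_abs, Function.comp_apply, ← List.append_assoc]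
    cases b
    · rfl
    · have e : R (p n ++ τ ++ [true]) = 2 * R (p n ++ τ) - R (p n ++ τ ++ [false]) := by
        linarith [hR (p n ++ τ)]
      rw [e, abs_sub_comm]
      push_cast
      congr 1
      ring
  induction τ using List.reverseRecOn with
  | nil => simp
  | append_singleton τ b ih =>
    have := (hstep τ b).add ih
    simpa using this

end Energy

/-! ### Convergence of bounded martingales along random paths -/

section Convergence

/-- When `|v| > r`, the right side is `(|v| - r)(|v| + r)`, at least `2r(|v| - r)`. -/
theorem two_mul_abs_sub_clip_le {r v : ℚ} (hr : 0 ≤ r) :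
    2 * r * |v - clip r v| ≤ v * v - clip r v * clip r v := by
  rcases le_total v (-r) with h | h
  · have : clip r v = -r := by
      rw [clip, min_eq_right (by linarith), max_eq_left h]
    rw [this, abs_of_nonpos (by linarith)]
    nlinarith
  · rcases le_total r v with h' | h'
    · have : clip r v = r := by
        rw [clip, min_eq_left h', max_eq_right (by linarith)]
      rw [this, abs_of_nonneg (by linarith)]
      nlinarith
    · have : clip r v = v := by
        rw [clip, min_eq_right h', max_eq_right h]
      simp [this]

/-- The play operator with radius `r` following `R`, together with the gain of the strategy that
bets according to the displacement. -/
def playState (R : List Bool → ℚ) (r : ℚ) : List Bool → ℚ × ℚ :=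
  pathRec (R [], 0) fun σ b s =>
    (R (σ ++ [b]) - clip r (R (σ ++ [b]) - s.1),
      s.2 + ((R (σ ++ [b]) - s.1) * (R (σ ++ [b]) - s.1) -
        clip r (R (σ ++ [b]) - s.1) * clip r (R (σ ++ [b]) - s.1)))

theorem playState_concat (R : List Bool → ℚ) (r : ℚ) (σ : List Bool) (b : Bool) :
    playState R r (σ ++ [b]) =
      (R (σ ++ [b]) - clip r (R (σ ++ [b]) - (playState R r σ).1),
        (playState R r σ).2 + ((R (σ ++ [b]) - (playState R r σ).1) *
          (R (σ ++ [b]) - (playState R r σ).1) -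
          clip r (R (σ ++ [b]) - (playState R r σ).1) *
            clip r (R (σ ++ [b]) - (playState R r σ).1))) :=
  pathRec_concat _ _ _ _

theorem computable_playState {R : List Bool → ℚ} (hR : Computable R) (r : ℚ) :
    Computable (playState R r) := by
  refine computable_pathRec _ ?_
  fun_prop

theorem abs_sub_playState_le (R : List Bool → ℚ) {r : ℚ} (hr : 0 ≤ r) (σ : List Bool) :
    |R σ - (playState R r σ).1| ≤ r := by
  induction σ using List.reverseRecOn with
  | nil => simpa [playState, pathRec_nil] using hr
  | append_singleton σ b _ =>
    rw [playState_concat, sub_sub_cancel, abs_le]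
    exact ⟨neg_le_clip _ _, clip_le hr _⟩

theorem playState_gain (R : List Bool → ℚ) {r : ℚ} (hr : 0 ≤ r) (σ : List Bool) (b : Bool) :
    2 * r * |(playState R r (σ ++ [b])).1 - (playState R r σ).1| ≤
      (playState R r (σ ++ [b])).2 - (playState R r σ).2 := by
  rw [playState_concat, add_sub_cancel_left]
  refine le_trans (le_of_eq ?_) (two_mul_abs_sub_clip_le hr)
  congr 2
  ring

/-- For each radius `r`, the play operator stays within `r` of `R`. The gain pays for its total
variation, so it has finite variation and is Cauchy along the path; letting `r` be small makes `R`
Cauchy. -/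
theorem IsRandomPath.exists_tendsto {p : ℕ → List Bool} (hp : IsRandomPath p)
    {R : List Bool → ℚ} {C : ℚ} (hc : Computable R) (hR : IsFair R) (hC : ∀ σ, |R σ| ≤ C) :
    ∃ d : ℝ, Tendsto (fun n => (R (p n) : ℝ)) atTop (𝓝 d) := by
  refine cauchySeq_tendsto_of_complete (Metric.cauchySeq_iff'.2 fun ε hε => ?_)
  obtain ⟨r, hr0, hrε⟩ := exists_rat_btwn (by linarith : 0 < ε / 3)
  have hr : 0 < r := by exact_mod_cast hr0
  have hsc := computable_playState hc r
  have hle := fun σ => abs_sub_playState_le R hr.le σ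
  have hmul (σ : List Bool) : (R σ - (playState R r σ).1) * (R σ - (playState R r σ).1) ≤ r * r :=
    by
      have := hle σ
      rw [← abs_mul_abs_self]
      exact mul_self_le_mul_self (abs_nonneg _) this
  have hmul' (σ : List Bool) : R σ * R σ ≤ C * C := by
    rw [← abs_mul_abs_self]
    exact mul_self_le_mul_self (abs_nonneg _) (hC σ)
  -- With the old play position `y` fixed, `-R² + (R - y)²` is affine in `R`, hence fair. Moving `y`
  -- lowers the squared displacement by exactly the recorded gain.
  have hex := hp.exists_le (Φ := fun σ => C * C - R σ * R σ +
      (R σ - (playState R r σ).1) * (R σ - (playState R r σ).1))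
    (B := fun σ => (playState R r σ).2) (c := C * C + r * r) (by fun_prop) (by fun_prop)
    (fun σ => by
      have e : R (σ ++ [true]) = 2 * R σ - R (σ ++ [false]) := by linarith [hR σ]
      simp only [playState_concat]
      rw [e]
      ring)
    (fun σ => by
      have := hmul' σ
      have := mul_self_nonneg (R σ - (playState R r σ).1)
      linarith)
    (fun σ => by
      have := hmul σ
      have := mul_self_nonneg (R σ)
      linarith)
    (by simp [playState, pathRec_nil])
    fun σ b => by
      have := playState_gain R hr.le σ b
      have : 0 ≤ 2 * r * |(playState R r (σ ++ [b])).1 - (playState R r σ).1| := by positivity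
      linarith
  have hsum : Summable fun n => 2 * (r : ℝ) * dist ((playState R r (p n)).1 : ℝ)
      ((playState R r (p (n + 1))).1 : ℝ) := by
    refine summable_of_le_increments (B := fun σ => (playState R r σ).2) hex (fun n => by positivity) fun n => ?_
    obtain ⟨b, hb⟩ := hp.1 n
    have := playState_gain R hr.le (p n) b
    rw [hb, dist_comm, Real.dist_eq]
    exact_mod_cast this
  rw [summable_mul_left_iff (by positivity)] at hsum
  have hcau := cauchySeq_of_summable_dist hsum
  obtain ⟨N, hN⟩ := Metric.cauchySeq_iff'.1 hcau (ε / 3) (by linarith)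
  refine ⟨N, fun n hn => ?_⟩
  have h1 := hN n hn
  have h2 : |(R (p n) : ℝ) - (playState R r (p n)).1| ≤ r := by exact_mod_cast hle (p n)
  have h3 : |(R (p N) : ℝ) - (playState R r (p N)).1| ≤ r := by exact_mod_cast hle (p N)
  rw [Real.dist_eq] at h1 ⊢
  rw [abs_lt] at h1 ⊢
  rw [abs_le] at h2 h3
  constructor <;> linarith

end Convergence

/-! ### From converging slopes to near linearity -/

section NearLinear

/-- Induction by halving: in the right half the midpoint contributes `ε / 2`, while the error at
depth zero, from the Lipschitz bound, halves with each level. -/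
theorem abs_sub_linear_le {G : ℝ → ℝ} {L d ε : ℝ} (hε : 0 ≤ ε)
    (hL : ∀ x ∈ Set.Icc (0 : ℝ) 1, ∀ y ∈ Set.Icc (0 : ℝ) 1, |G x - G y| ≤ L * |x - y|) (k : ℕ)
    (σ : List Bool) (h : ∀ τ : List Bool, τ.length ≤ k → |slopeOn G (σ ++ τ) - d| ≤ ε) {x : ℝ}
    (hx1 : (num σ : ℝ) / 2 ^ σ.length ≤ x) (hx2 : x ≤ (num σ + 1) / 2 ^ σ.length) :
    |G x - G (num σ / 2 ^ σ.length) - d * (x - num σ / 2 ^ σ.length)| ≤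
      (ε + (L + |d|) / 2 ^ k) / 2 ^ σ.length := by
  induction k generalizing σ with
  | zero =>
    set a : ℝ := num σ / 2 ^ σ.length with ha
    have h0 := num_div_nonneg σ
    have h1 := num_add_one_div_le_one σ
    have hG := hL x ⟨h0.trans hx1, hx2.trans h1⟩ a ⟨h0, hx1.trans (hx2.trans h1)⟩
    have hxa : |x - a| ≤ 1 / 2 ^ σ.length := by
      rw [abs_of_nonneg (by linarith)]
      rw [add_div, ← ha] at hx2
      linarith
    have hL0 : 0 ≤ L := by
      have := hL 1 (by simp) 0 (by simp)
      simp only [sub_zero, abs_one, mul_one] at this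
      exact (abs_nonneg _).trans this
    calc |G x - G a - d * (x - a)| ≤ |G x - G a| + |d * (x - a)| := abs_sub _ _
      _ ≤ L * |x - a| + |d| * |x - a| := by rw [abs_mul]; gcongr
      _ = (L + |d|) * |x - a| := by ring
      _ ≤ (L + |d|) * (1 / 2 ^ σ.length) := by gcongr
      _ ≤ (ε + (L + |d|) / 2 ^ 0) / 2 ^ σ.length := by
        rw [pow_zero, div_one, mul_one_div]
        exact div_le_div_of_nonneg_right (by linarith) (by positivity)
  | succ k ih =>
    have c0 := ih (σ ++ [false]) fun τ hτ => by
      rw [List.append_assoc]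
      exact h _ (by simp; omega)
    have c1 := ih (σ ++ [true]) fun τ hτ => by
      rw [List.append_assoc]
      exact h _ (by simp; omega)
    have hs := h [false] (by simp)
    have e1 : (2 * (num σ : ℝ)) / 2 ^ (σ.length + 1) = num σ / 2 ^ σ.length := by
      rw [pow_succ]; field_simp
    have e2 : (2 * (num σ : ℝ) + 1 + 1) / 2 ^ (σ.length + 1) = (num σ + 1) / 2 ^ σ.length := by
      rw [pow_succ]; field_simp; ring
    simp only [slopeOn, num_concat, List.length_append, List.length_singleton, Bool.toNat_false,
      Bool.toNat_true, add_zero] at c0 c1 hs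
    push_cast at c0 c1 hs
    rw [e1] at c0 hs
    rw [e2] at c1
    set a : ℝ := num σ / 2 ^ σ.length with ha
    set m : ℝ := (2 * num σ + 1) / 2 ^ (σ.length + 1) with hm
    set E : ℝ := (L + |d|) / 2 ^ k with hE
    have e3 : (L + |d|) / 2 ^ (k + 1) = E / 2 := by rw [hE, pow_succ]; field_simp
    have e4 : (ε + E) / 2 ^ (σ.length + 1) = (ε + E) / 2 / 2 ^ σ.length := by
      rw [pow_succ]; field_simp
    have e5 : (ε + (L + |d|) / 2 ^ (k + 1)) / 2 ^ σ.length =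
        (ε + E) / 2 / 2 ^ σ.length + ε / 2 / 2 ^ σ.length := by
      rw [e3]; ring
    have hε' : 0 ≤ ε / 2 / 2 ^ σ.length := by positivity
    rw [e4] at c0 c1
    rw [e5]
    rcases le_total x m with hxm | hxm
    · exact (c0 hx1 hxm).trans (by linarith)
    · have hma : m - a = 1 / 2 / 2 ^ σ.length := by
        rw [hm, ha, pow_succ]; field_simp; ring
      have c2 : |G m - G a - d * (m - a)| ≤ ε / 2 / 2 ^ σ.length := by
        have e6 : G m - G a - d * (m - a) =
            (2 ^ (σ.length + 1) * (G m - G a) - d) * (1 / 2 / 2 ^ σ.length) := by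
          rw [hma, pow_succ]; field_simp
        have hp : (0 : ℝ) < 1 / 2 / 2 ^ σ.length := by positivity
        rw [e6, abs_mul, abs_of_pos hp]
        refine (mul_le_mul_of_nonneg_right hs hp.le).trans (le_of_eq ?_)
        ring
      have e7 : G x - G a - d * (x - a) =
        (G x - G m - d * (x - m)) + (G m - G a - d * (m - a)) := by ring
      rw [e7]
      exact (abs_add_le _ _).trans (add_le_add (c1 hxm hx2) c2)

theorem abs_slopeOn_le {G : ℝ → ℝ} {L : ℝ}
    (hL : ∀ x ∈ Set.Icc (0 : ℝ) 1, ∀ y ∈ Set.Icc (0 : ℝ) 1, |G x - G y| ≤ L * |x - y|)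
    (σ : List Bool) : |slopeOn G σ| ≤ L := by
  have h1 := num_div_nonneg σ
  have h2 := num_div_le_num_add_one_div σ
  have h3 := num_add_one_div_le_one σ
  have := hL _ ⟨h1.trans h2, h3⟩ _ ⟨h1, h2.trans h3⟩
  have e : |((num σ : ℝ) + 1) / 2 ^ σ.length - num σ / 2 ^ σ.length| = 1 / 2 ^ σ.length := by
    rw [← sub_div, add_sub_cancel_left, abs_of_pos (by positivity)]
  rw [e, mul_one_div, le_div_iff₀ (by positivity)] at this
  rw [slopeOn, abs_mul, abs_of_pos (by positivity)]
  linarith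

/-- A bounded rational `R` tracks the slopes. It converges along the path, and `R - slopeOn G` is
Cauchy there. Neither `R` nor this difference changes in the limit on appending `τ`, so `d` does not
depend on `τ`. -/
theorem IsRandomPath.exists_tendsto_slopeOn {y : ℝ} (hp : IsRandomPath (path y))
    {G : ℝ → ℝ} {L : ℝ} (hG : HasRatApprox G)
    (hL : ∀ x ∈ Set.Icc (0 : ℝ) 1, ∀ y ∈ Set.Icc (0 : ℝ) 1, |G x - G y| ≤ L * |x - y|) :
    ∃ d, ∀ τ, Tendsto (fun n => slopeOn G (path y n ++ τ)) atTop (𝓝 d) := by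
  obtain ⟨R, hRc, hR, hRM, hRM'⟩ := hG.slopeOn.exists_rat_martingale (slopeOn_fair G)
  obtain ⟨C, hC⟩ := exists_rat_gt (L + 3)
  have hRC (σ : List Bool) : |R σ| ≤ C := by
    have h1 := abs_le.1 (hRM' σ)
    have h2 := abs_le.1 (abs_slopeOn_le hL σ)
    have : |(R σ : ℝ)| ≤ C := by rw [abs_le]; constructor <;> linarith
    exact_mod_cast this
  obtain ⟨d, hd⟩ := hp.exists_tendsto hRc hR hRC
  have hlim : Tendsto (fun n : ℕ => (2 : ℝ) / 2 ^ n) atTop (𝓝 0) := by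
    have := (tendsto_pow_atTop_nhds_zero_of_lt_one (r := (1 / 2 : ℝ)) (by norm_num)
      (by norm_num)).const_mul 2
    simpa [one_div_pow, div_eq_mul_inv] using this
  have hcau : CauchySeq fun n => (R (path y n) : ℝ) - slopeOn G (path y n) := by
    refine cauchySeq_of_le_tendsto_0' (fun n : ℕ => (2 : ℝ) / 2 ^ n) (fun n m hnm => ?_) hlim
    have : ∃ τ, path y m = path y n ++ τ := by
      induction m, hnm using Nat.le_induction with
      | base => exact ⟨[], by simp⟩
      | succ m _ ih =>
        obtain ⟨τ, hτ⟩ := ih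
        obtain ⟨b, hb⟩ := hp.1 m
        exact ⟨τ ++ [b], by rw [hb, hτ, List.append_assoc]⟩
    obtain ⟨τ, hτ⟩ := this
    have := hRM (path y n) τ
    rw [length_path] at this
    rwa [hτ, dist_comm, Real.dist_eq]
  obtain ⟨e, he⟩ := cauchySeq_tendsto_of_complete hcau
  refine ⟨d - e, fun τ => ?_⟩
  have h1 := hp.tendsto_append_sub hRc hR hRC τ
  have h2 : Tendsto (fun n => ((R (path y n ++ τ) : ℝ) - slopeOn G (path y n ++ τ)) -
      (R (path y n) - slopeOn G (path y n))) atTop (𝓝 0) := by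
    refine squeeze_zero_norm (fun n => ?_) hlim
    have := hRM (path y n) τ
    rwa [length_path] at this
  have h3 := (hd.sub he).add (h1.sub h2)
  simp only [sub_self, add_zero] at h3
  refine h3.congr fun n => ?_
  ring

theorem IsRandomPath.exists_slope {y : ℝ} (hp : IsRandomPath (path y)) {G : ℝ → ℝ} {L : ℝ}
    (hG : HasRatApprox G)
    (hL : ∀ x ∈ Set.Icc (0 : ℝ) 1, ∀ y ∈ Set.Icc (0 : ℝ) 1, |G x - G y| ≤ L * |x - y|) :
    ∃ d, ∀ ε > 0, ∀ᶠ n in atTop, ∀ x ∈ Set.Icc ((num (path y n) : ℝ) / 2 ^ n)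
      ((num (path y n) + 1) / 2 ^ n), ∀ x' ∈ Set.Icc ((num (path y n) : ℝ) / 2 ^ n)
      ((num (path y n) + 1) / 2 ^ n), |G x - G x' - d * (x - x')| ≤ ε / 2 ^ n := by
  obtain ⟨d, hd⟩ := hp.exists_tendsto_slopeOn hG hL
  refine ⟨d, fun ε hε => ?_⟩
  -- At this depth the Lipschitz error and the slope error are each at most `ε / 4`; comparing `x`
  -- and `x'` through the left endpoint doubles their sum.
  obtain ⟨k, hk⟩ := pow_unbounded_of_one_lt ((L + |d|) / (ε / 4)) (by norm_num : (1 : ℝ) < 2)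
  have hk' : (L + |d|) / 2 ^ k ≤ ε / 4 := by
    rw [div_lt_iff₀ (by positivity)] at hk
    rw [div_le_iff₀ (by positivity)]
    linarith
  have hev : ∀ᶠ n in atTop, ∀ τ ∈ {τ : List Bool | τ.length ≤ k},
      |slopeOn G (path y n ++ τ) - d| ≤ ε / 4 := by
    refine (List.finite_length_le Bool k).eventually_all.2 fun τ _ => ?_
    have := (Metric.tendsto_nhds.1 (hd τ)) (ε / 4) (by positivity)
    filter_upwards [this] with n hn
    rw [Real.dist_eq] at hn
    exact hn.le
  filter_upwards [hev] with n hn x hx x' hx'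
  have h1 := abs_sub_linear_le (by positivity) hL k (path y n) hn (x := x)
  have h2 := abs_sub_linear_le (by positivity) hL k (path y n) hn (x := x')
  rw [length_path] at h1 h2
  have h1 := h1 hx.1 hx.2
  have h2 := h2 hx'.1 hx'.2
  set a : ℝ := num (path y n) / 2 ^ n
  have e : G x - G x' - d * (x - x') =
    (G x - G a - d * (x - a)) - (G x' - G a - d * (x' - a)) := by ring
  rw [e]
  refine (abs_sub _ _).trans ((add_le_add h1 h2).trans ?_)
  rw [← add_div]
  gcongr
  linarith

end NearLinear

/-! ### Two shifted grids and differentiability -/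

section Grids

/-- The constant extension to `ℝ` of a function on `[0, 1]`. -/
noncomputable def extendUnit (f : ℝ → ℝ) (u : ℝ) : ℝ := f (max 0 (min 1 u))

theorem extendUnit_of_mem (f : ℝ → ℝ) {u : ℝ} (hu : u ∈ Set.Icc (0 : ℝ) 1) :
    extendUnit f u = f u := by
  rw [extendUnit, min_eq_right hu.2, max_eq_right hu.1]

/-- The `N`-th interval of the dyadic grid of mesh `2 / 2 ^ n` shifted by `-θ`. -/
def gridInterval (θ : ℝ) (n N : ℕ) : Set ℝ :=
  {u | (N : ℝ) ≤ 2 ^ n * ((u + θ) / 2) ∧ 2 ^ n * ((u + θ) / 2) ≤ N + 1}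

theorem IsComputablyRandomSeq.exists_slope {Z : ℕ → Bool} (hZ : IsComputablyRandomSeq Z) {z : ℝ}
    (hz : IsBinaryExpansion Z z) {f : ℝ → ℝ} (hf : HasRatApprox f) {L : ℝ} (hL0 : 0 ≤ L)
    (hL : ∀ x ∈ Set.Icc (0 : ℝ) 1, ∀ y ∈ Set.Icc (0 : ℝ) 1, |f x - f y| ≤ L * |x - y|)
    {θ : ℚ} (hθ0 : 0 ≤ θ) (hθ1 : θ ≤ 1) :
    ∃ d, ∀ ε > 0, ∀ᶠ n in atTop, ∃ N : ℕ, z ∈ gridInterval θ n N ∧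
      ∀ u ∈ gridInterval θ n N, ∀ u' ∈ gridInterval θ n N,
        |extendUnit f u - extendUnit f u' - d * (u - u')| ≤ ε / 2 ^ n := by
  have hz0 : 0 ≤ z := by simpa [initialSegment] using hz.num_div_le 0
  have hz1 : z ≤ 1 := by simpa [initialSegment] using hz.le_num_add_one_div 0
  have hz1' : z < 1 := lt_of_le_of_ne hz1 (by simpa using hZ.ne_rat hz 1)
  have hθ0' : (0 : ℝ) ≤ θ := by exact_mod_cast hθ0
  have hθ1' : (θ : ℝ) ≤ 1 := by exact_mod_cast hθ1
  have hy0 : 0 ≤ (z + θ) / 2 := by positivity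
  have hy1 : (z + θ) / 2 < 1 := by linarith
  have hclip (a : ℝ) : max 0 (min 1 a) ∈ Set.Icc (0 : ℝ) 1 :=
    ⟨le_max_left _ _, max_le zero_le_one (min_le_left _ _)⟩
  have hclip' (a b : ℝ) : |max 0 (min 1 a) - max 0 (min 1 b)| ≤ |a - b| :=
    by
    have h1 := abs_max_sub_max_le_abs (min 1 a) (min 1 b) 0
    have h2 := abs_min_sub_min_le_max 1 a 1 b
    rw [max_comm 0, max_comm 0]
    refine h1.trans (h2.trans ?_)
    simp
  -- The inverse substitution carries dyadic intervals around `(z + θ) / 2` to grid intervals around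
  -- `z`. Clamping is needed because these may leave the unit interval.
  set G : ℝ → ℝ := fun x => f (max 0 (min 1 (x + x - θ))) with hG
  have hGa : HasRatApprox G := by
    refine hf.comp (φ := fun q => max 0 (min 1 (q + q - θ))) (by fun_prop)
      (fun q _ _ => ⟨le_max_left _ _, max_le zero_le_one (min_le_left _ _)⟩)
      (ψ := fun x => max 0 (min 1 (x + x - θ))) fun q => ?_
    push_cast
    rfl
  have hGL : ∀ x ∈ Set.Icc (0 : ℝ) 1, ∀ y ∈ Set.Icc (0 : ℝ) 1, |G x - G y| ≤ 2 * L * |x - y| := by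
    intro x _ y _
    refine (hL _ (hclip _) _ (hclip _)).trans
      ((mul_le_mul_of_nonneg_left (hclip' _ _) hL0).trans (le_of_eq ?_))
    have e : x + x - θ - (y + y - θ) = 2 * (x - y) := by ring
    rw [e, abs_mul, abs_two]
    ring
  have hGu (u : ℝ) : G ((u + θ) / 2) = extendUnit f u := by
    simp only [hG, extendUnit]
    congr 3
    ring
  obtain ⟨d, hd⟩ := (hZ.isRandomPath hz hz0 hθ0 hθ1).exists_slope hGa hGL
  refine ⟨d / 2, fun ε hε => ?_⟩
  filter_upwards [hd ε hε] with n hn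
  have hI {u : ℝ} : u ∈ gridInterval θ n (num (path ((z + θ) / 2) n)) ↔
      (u + θ) / 2 ∈ Set.Icc ((num (path ((z + θ) / 2) n) : ℝ) / 2 ^ n)
        ((num (path ((z + θ) / 2) n) + 1) / 2 ^ n) := by
    rw [Set.mem_Icc, div_le_iff₀' (by positivity), le_div_iff₀' (by positivity)]
    rfl
  refine ⟨num (path ((z + θ) / 2) n), hI.2 ⟨num_path_div_le hy0 hy1 n,
    (lt_num_path_add_one_div hy0 hy1 n).le⟩, fun u hu u' hu' => ?_⟩
  have := hn _ (hI.1 hu) _ (hI.1 hu')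
  rw [hGu, hGu] at this
  have e : d * ((u + θ) / 2 - (u' + θ) / 2) = d / 2 * (u - u') := by ring
  rwa [e] at this

theorem int_three_mul_ne_two_pow (i : ℤ) (n : ℕ) : 3 * i ≠ 2 ^ n := by
  intro h
  have h1 : (3 : ℤ) ∣ 2 ^ n := ⟨i, h.symm⟩
  have h2 := Int.prime_three.dvd_of_dvd_pow h1
  norm_num at h2

/-- In units of the mesh, endpoints of the two grids are at least `1/3` apart, since `3` does not
divide `2 ^ n`. If `u` left both intervals, an endpoint of each would lie between `z` and `u`, which
are at most `1/6` apart. -/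
theorem mem_gridInterval_or {n N₀ N₁ : ℕ} {z u : ℝ} (hz₀ : z ∈ gridInterval 0 (n + 1) N₀)
    (hz₁ : z ∈ gridInterval (1 / 3) (n + 1) N₁) (hu : 3 * |u - z| ≤ (1 / 2) ^ (n + 1)) :
    u ∈ gridInterval 0 (n + 1) N₀ ∨ u ∈ gridInterval (1 / 3) (n + 1) N₁ := by
  set P : ℝ := 2 ^ n with hP
  have hP0 : 0 < P := by positivity
  have hu' : |P * u - P * z| ≤ 1 / 6 := by
    rw [← mul_sub, abs_mul, abs_of_pos hP0]
    have e : P * (1 / 2) ^ (n + 1) = 1 / 2 := by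
      rw [one_div_pow, pow_succ, hP]; field_simp
    have := mul_le_mul_of_nonneg_left hu hP0.le
    linarith
  have hint (i j : ℤ) : (3 * (j - i) : ℝ) - P ≤ -1 ∨ 1 ≤ (3 * (j - i) : ℝ) - P := by
    have h := int_three_mul_ne_two_pow (j - i) n
    rcases lt_or_gt_of_ne h with h | h
    · left
      have h1 : 3 * (j - i) ≤ 2 ^ n - 1 := by linarith [Int.add_one_le_of_lt h]
      have h2 : ((3 * (j - i) : ℤ) : ℝ) ≤ ((2 ^ n - 1 : ℤ) : ℝ) := Int.cast_le.2 h1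
      push_cast at h2
      linarith
    · right
      have h1 : 2 ^ n + 1 ≤ 3 * (j - i) := by linarith [Int.add_one_le_of_lt h]
      have h2 : ((2 ^ n + 1 : ℤ) : ℝ) ≤ ((3 * (j - i) : ℤ) : ℝ) := Int.cast_le.2 h1
      push_cast at h2
      linarith
  have e0 (v : ℝ) : (2 : ℝ) ^ (n + 1) * ((v + 0) / 2) = P * v := by rw [pow_succ]; ring
  have e1 (v : ℝ) : (2 : ℝ) ^ (n + 1) * ((v + 1 / 3) / 2) = P * v + P / 3 := by
    rw [pow_succ]; ring
  simp only [gridInterval, Set.mem_ofPred_eq, e0, e1] at hz₀ hz₁ ⊢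
  rw [abs_le] at hu'
  have a1 := hint N₀ N₁
  have a2 := hint N₀ (N₁ + 1)
  have a3 := hint (N₀ + 1) N₁
  have a4 := hint (N₀ + 1) (N₁ + 1)
  push_cast at a1 a2 a3 a4
  by_contra! hcon
  obtain ⟨c0, c1⟩ := hcon
  rcases lt_or_ge (P * u) N₀ with h | h
  · rcases lt_or_ge (P * u + P / 3) N₁ with h' | h'
    · rcases a1 with a | a <;> linarith
    · have := c1 h'
      rcases a2 with a | a <;> linarith
  · have h := c0 h
    rcases lt_or_ge (P * u + P / 3) N₁ with h' | h'
    · rcases a3 with a | a <;> linarith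
    · have := c1 h'
      rcases a4 with a | a <;> linarith

/-- Both intervals contain `z`, so `3(N₁ - N₀) - 2 ^ n` lies between `-3` and `3`. Divisibility by
`3` excludes the extremes, leaving an overlap of at least a third of the mesh. -/
theorem exists_mem_gridIntervals {n N₀ N₁ : ℕ} {z : ℝ} (hz₀ : z ∈ gridInterval 0 (n + 1) N₀)
    (hz₁ : z ∈ gridInterval (1 / 3) (n + 1) N₁) :
    ∃ u u', u ∈ gridInterval 0 (n + 1) N₀ ∧ u' ∈ gridInterval 0 (n + 1) N₀ ∧
      u ∈ gridInterval (1 / 3) (n + 1) N₁ ∧ u' ∈ gridInterval (1 / 3) (n + 1) N₁ ∧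
      u' - u = 1 / (3 * 2 ^ n) := by
  set P : ℝ := 2 ^ n with hP
  have hP0 : 0 < P := by positivity
  have e0 (v : ℝ) : (2 : ℝ) ^ (n + 1) * ((v + 0) / 2) = P * v := by rw [pow_succ]; ring
  have e1 (v : ℝ) : (2 : ℝ) ^ (n + 1) * ((v + 1 / 3) / 2) = P * v + P / 3 := by
    rw [pow_succ]; ring
  simp only [gridInterval, Set.mem_ofPred_eq, e0, e1] at hz₀ hz₁ ⊢
  have hlow : (-2 : ℝ) ≤ 3 * (N₁ - N₀) - P := by
    have h1 : ((-3 : ℤ) : ℝ) ≤ ((3 * (N₁ - N₀) - 2 ^ n : ℤ) : ℝ) := by push_cast; linarith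
    have h2 := int_three_mul_ne_two_pow (N₁ - N₀ + 1) n
    have h3 := Int.cast_le.1 h1
    have h4 : (-2 : ℤ) ≤ 3 * (N₁ - N₀) - 2 ^ n := by omega
    have h5 := (Int.cast_le (R := ℝ)).2 h4
    push_cast at h5
    linarith
  have hhigh : 3 * (N₁ - N₀) - P ≤ (2 : ℝ) := by
    have h1 : ((3 * (N₁ - N₀) - 2 ^ n : ℤ) : ℝ) ≤ ((3 : ℤ) : ℝ) := by push_cast; linarith
    have h2 := int_three_mul_ne_two_pow (N₁ - N₀ - 1) n
    have h3 := Int.cast_le.1 h1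
    have h4 : (3 * (N₁ - N₀) - 2 ^ n : ℤ) ≤ 2 := by omega
    have h5 := (Int.cast_le (R := ℝ)).2 h4
    push_cast at h5
    linarith
  have hm1 : (N₀ : ℝ) ≤ max (N₀ : ℝ) (N₁ - P / 3) := le_max_left _ _
  have hm2 : (N₁ - P / 3 : ℝ) ≤ max (N₀ : ℝ) (N₁ - P / 3) := le_max_right _ _
  have hm3 : max (N₀ : ℝ) (N₁ - P / 3) ≤ N₀ + 2 / 3 := max_le (by linarith) (by linarith)
  have hm4 : max (N₀ : ℝ) (N₁ - P / 3) ≤ N₁ - P / 3 + 2 / 3 := max_le (by linarith) (by linarith)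
  set w := max (N₀ : ℝ) (N₁ - P / 3)
  have ew : P * (w / P) = w := by field_simp
  have ew' : P * ((w + 1 / 3) / P) = w + 1 / 3 := by field_simp
  refine ⟨w / P, (w + 1 / 3) / P, ?_⟩
  rw [ew, ew']
  refine ⟨⟨?_, ?_⟩, ⟨?_, ?_⟩, ⟨?_, ?_⟩, ⟨?_, ?_⟩, ?_⟩ <;> try linarith
  field_simp
  ring

theorem IsComputablyRandomSeq.differentiableWithinAt {Z : ℕ → Bool}
    (hZ : IsComputablyRandomSeq Z) {z : ℝ} (hz : IsBinaryExpansion Z z) {f : ℝ → ℝ}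
    (hf : IsComputableOnRationals f) {c : NNReal}
    (hc : LipschitzOnWith c f (Set.Icc (0 : ℝ) 1)) :
    DifferentiableWithinAt ℝ f (Set.Icc (0 : ℝ) 1) z := by
  have hz0 : 0 ≤ z := by simpa [initialSegment] using hz.num_div_le 0
  have hz1 : z ≤ 1 := by simpa [initialSegment] using hz.le_num_add_one_div 0
  have hL : ∀ x ∈ Set.Icc (0 : ℝ) 1, ∀ y ∈ Set.Icc (0 : ℝ) 1, |f x - f y| ≤ c * |x - y| := by
    intro x hx y hy
    have := hc.dist_le_mul x hx y hy
    rwa [Real.dist_eq, Real.dist_eq] at this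
  obtain ⟨d, hd⟩ := hZ.exists_slope hz hf.hasRatApprox c.coe_nonneg hL (θ := 0) le_rfl zero_le_one
  obtain ⟨d', hd'⟩ := hZ.exists_slope hz hf.hasRatApprox c.coe_nonneg hL (θ := 1 / 3) (by norm_num)
    (by norm_num)
  push_cast at hd hd'
  have hdd : d = d' := by
    refine eq_of_abs_sub_le_all fun ε hε => ?_
    obtain ⟨n₀, hn₀⟩ := eventually_atTop.1 ((hd (ε / 3) (by positivity)).and
      (hd' (ε / 3) (by positivity)))
    obtain ⟨⟨N₀, hN₀, h₀⟩, N₁, hN₁, h₁⟩ := hn₀ (n₀ + 1) (by omega)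
    obtain ⟨u, u', hu₀, hu₀', hu₁, hu₁', huu⟩ := exists_mem_gridIntervals hN₀ hN₁
    have a0 := h₀ _ hu₀' _ hu₀
    have a1 := h₁ _ hu₁' _ hu₁
    have hp : (0 : ℝ) < 1 / (3 * 2 ^ n₀) := by positivity
    rw [huu, abs_le] at a0 a1
    have e : ε / 3 / 2 ^ (n₀ + 1) = ε / 2 * (1 / (3 * 2 ^ n₀)) := by
      rw [pow_succ]; field_simp
    rw [e] at a0 a1
    have b : |d - d'| * (1 / (3 * 2 ^ n₀)) ≤ ε * (1 / (3 * 2 ^ n₀)) := by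
      rw [← abs_of_pos hp, ← abs_mul, abs_of_pos hp, abs_le]
      constructor <;> linarith
    exact le_of_mul_le_mul_right b hp
  subst hdd
  refine HasDerivWithinAt.differentiableWithinAt (f' := d)
    (hasDerivWithinAt_iff_isLittleO.2 (Asymptotics.isLittleO_iff.2 fun ε hε => ?_))
  obtain ⟨n₀, hn₀⟩ := eventually_atTop.1 ((hd (ε / 6) (by positivity)).and
    (hd' (ε / 6) (by positivity)))
  rw [eventually_nhdsWithin_iff, Metric.eventually_nhds_iff]
  refine ⟨(1 / 2) ^ (n₀ + 1) / 3, by positivity, fun u hu hu01 => ?_⟩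
  rw [Real.dist_eq] at hu
  rw [Real.norm_eq_abs, Real.norm_eq_abs, smul_eq_mul]
  rcases eq_or_ne u z with rfl | huz
  · simp
  have hpos : 0 < |u - z| := abs_pos.2 (sub_ne_zero.2 huz)
  have hlt1 : (1 / 2 : ℝ) ^ (n₀ + 1) ≤ 1 := pow_le_one₀ (by norm_num) (by norm_num)
  obtain ⟨n, hn1, hn2⟩ := exists_nat_pow_near_of_lt_one (x := 3 * |u - z|) (y := 1 / 2)
    (by positivity) (by linarith) (by norm_num) (by norm_num)
  have hnn : n₀ + 1 < n + 1 := by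
    refine (pow_lt_pow_iff_right_of_lt_one₀ (by norm_num : (0 : ℝ) < 1 / 2) (by norm_num)).1 ?_
    linarith
  obtain ⟨⟨N₀, hN₀, h₀⟩, N₁, hN₁, h₁⟩ := hn₀ n (by omega)
  obtain ⟨m, rfl⟩ : ∃ m, n = m + 1 := ⟨n - 1, by omega⟩
  have key : |extendUnit f u - extendUnit f z - d * (u - z)| ≤ ε / 6 / 2 ^ (m + 1) := by
    rcases mem_gridInterval_or hN₀ hN₁ hn2 with h | h
    · exact h₀ u h z hN₀
    · exact h₁ u h z hN₁
  rw [extendUnit_of_mem f hu01, extendUnit_of_mem f ⟨hz0, hz1⟩, mul_comm d] at key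
  refine key.trans ?_
  -- The scale was chosen with `(1 / 2) ^ (m + 2) < 3 * |u - z|`, so this error is at most `ε * |u -
  -- z|`.
  have e : ε / 6 / 2 ^ (m + 1) = ε / 3 * (1 / 2) ^ (m + 1 + 1) := by
    rw [one_div_pow, pow_succ _ (m + 1)]; field_simp; norm_num
  rw [e]
  have := mul_le_mul_of_nonneg_left hn1.le (by positivity : 0 ≤ ε / 3)
  linarith

end Grids

end CompRandom

theorem theorem4p2 (z : ℝ) (hz : z ∈ Set.Icc (0 : ℝ) 1) :
    CompRandom.IsComputablyRandom z ↔
      ∀ f : ℝ → ℝ, CompRandom.IsComputableOnUnitInterval f →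
        (∃ c : NNReal, LipschitzOnWith c f (Set.Icc (0 : ℝ) 1)) →
          DifferentiableWithinAt ℝ f (Set.Icc (0 : ℝ) 1) z := by
  constructor
  · rintro ⟨Z, hZ, hZr⟩ f hf ⟨c, hc⟩
    exact hZr.differentiableWithinAt hZ hf.1 hc
  · intro h
    by_contra hz'
    obtain ⟨f, hf, hc, hd⟩ := CompRandom.exists_not_differentiableWithinAt hz hz'
    exact hd (h f hf hc)
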